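/- Let $d\ge 1$ be an integer. A *cone* in $\mathbb R^d$ is a set $C=\mathbb R_+x_1+\cdots+\mathbb R_+x_n$ with $n\ge 0$ and $x_1,\dots,x_n\in\mathbb Z^d$ such that no nonzero $x\in C$ has $-x\in C$; put $\mathsf L(C)=C\cap\mathbb Z^d$. Let $\operatorname{Cones}(d)$ be the set of cones in $\mathbb R^d$, partially ordered as follows: $C<D$ if and only if there are $n\ge1$ and cones $C=C_0\subset C_1\subset\cdots\subset C_n=D$ such that for every $i=1,\dots,n$ one has $\mathsf L(C_i)=\mathsf L(C_{i-1})+\mathbb Z_+x$ for some $x\in C_i\setminus C_{i-1}$. Let $\operatorname{Cones}^+(d)$ be the subposet (with the induced order) of the cones contained in $(\mathbb R^{d-1}\times\mathbb R_{>0})\cup\{0\}$. The geometric realization $|\Pi|$ of a poset $\Pi$ is the geometric realization, with the weak topology, of its order complex, i.e. of the simplicial complex whose faces are the nonempty finite chains of $\Pi$. Assume that the order in $\operatorname{Cones}(d)$ is the inclusion order, i.e. that for all $C,D\in\operatorname{Cones}(d)$ one has $C\le D$ if and only if $C\subseteq D$. Then: (a) The spaces $|\operatorname{Cones}(d)|$,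 $|\operatorname{Cones}^+(d)|$ and $|\operatorname{Cones}^+(d)\setminus\{0\}|$ are contractible. (b) $|\operatorname{Cones}(d)\setminus\{0\}|$ is a filtered union of spaces, each containing a $(d-1)$-sphere as a strong deformation retract. That is, there is a family $\mathcal S$ of closed subspaces of $X=|\operatorname{Cones}(d)\setminus\{0\}|$ that is directed under inclusion, has union $X$ and determines the topology of $X$ (a subset of $X$ is open as soon as its intersection with every $S\in\mathcal S$ is open in $S$), such that every $S\in\mathcal S$ has a subspace $A\subset S$ that is homeomorphic to the unit sphere of $\mathbb R^d$ and is a strong deformation retract of $S$ (there is a homotopy of maps $S\to S$, fixing $A$ pointwise at all times, from the identity of $S$ to a map with values in $A$). -/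

import Mathlib

/-! ### Rational cones and their poset -/

/-- The inclusion of the integer lattice `ℤ^d` into `ℝ^d`. -/
def latticeVec {d : ℕ} (z : Fin d → ℤ) : Fin d → ℝ := fun i => (z i : ℝ)

/-- A cone in `ℝ^d`: the set of nonnegative real combinations of finitely many integer vectors
that contains no nonzero `x` together with `-x`. -/
@[ext]
structure Cones (d : ℕ) where
  toCone : PointedCone ℝ (Fin d → ℝ)
  rational : ∃ s : Finset (Fin d → ℤ), toCone = PointedCone.hull ℝ (latticeVec '' (s : Set _))
  salient : ∀ x ∈ toCone, -x ∈ toCone → x = 0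

namespace Cones

variable {d : ℕ}

/-- The zero cone. -/
instance : Zero (Cones d) where
  zero :=
    { toCone := ⊥
      rational := ⟨∅, by simp⟩
      salient := fun x hx _ => by simpa using hx }

/-- The set of lattice points of a cone. -/
def latticePoints (C : Cones d) : Set (Fin d → ℤ) := {z | latticeVec z ∈ C.toCone}

/-- `D` is an elementary extension of `C`: `C ⊆ D` and `L(D) = L(C) + ℤ₊ x` for some
`x ∈ D \ C`. (Such an `x` lies in `L(D)`, so it is taken in `ℤ^d`.) -/
def IsElementaryExtension (C D : Cones d) : Prop :=
  C.toCone ≤ D.toCone ∧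
    ∃ x : Fin d → ℤ, latticeVec x ∈ D.toCone ∧ latticeVec x ∉ C.toCone ∧
      D.latticePoints = {z | ∃ c ∈ C.latticePoints, ∃ n : ℕ, z = c + n • x}

theorem IsElementaryExtension.lt {C D : Cones d} (h : IsElementaryExtension C D) :
    C.toCone < D.toCone := by
  obtain ⟨hle, x, hxD, hxC, -⟩ := h
  exact lt_of_le_of_ne hle fun e => hxC (e ▸ hxD)

theorem toCone_lt_of_transGen {C D : Cones d}
    (h : Relation.TransGen IsElementaryExtension C D) : C.toCone < D.toCone := by
  induction h with
  | single h => exact h.lt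
  | tail _ h ih => exact ih.trans h.lt

/-- The order of `Cones d`: `C < D` iff `D` is reached from `C` by a finite nonempty sequence of
elementary extensions. -/
instance : PartialOrder (Cones d) where
  le := Relation.ReflTransGen IsElementaryExtension
  lt := Relation.TransGen IsElementaryExtension
  le_refl _ := Relation.ReflTransGen.refl
  le_trans _ _ _ h₁ h₂ := h₁.trans h₂
  lt_iff_le_not_ge C D := by
    constructor
    · intro h
      refine ⟨h.to_reflTransGen, fun h' => ?_⟩
      exact lt_irrefl _ (toCone_lt_of_transGen (h.trans_left h'))
    · rintro ⟨h, h'⟩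
      rcases Relation.reflTransGen_iff_eq_or_transGen.1 h with e | h
      · subst e
        exact absurd Relation.ReflTransGen.refl h'
      · exact h
  le_antisymm C D h h' := by
    rcases Relation.reflTransGen_iff_eq_or_transGen.1 h with e | h
    · exact e.symm
    · exact absurd (toCone_lt_of_transGen (h.trans_left h')) (lt_irrefl _)

/-- The order of `Cones d` is the inclusion order. -/
def OrderIsInclusion (d : ℕ) : Prop :=
  ∀ C D : Cones d, C ≤ D ↔ (C.toCone : Set (Fin d → ℝ)) ⊆ D.toCone

/-- `C` lies in `(ℝ^(d-1) × ℝ_{>0}) ∪ {0}`: the last coordinate, the one with index `d - 1`, is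
positive at every nonzero point of `C`. -/
def IsPlus (C : Cones d) : Prop :=
  ∀ x ∈ C.toCone, x ≠ 0 → ∀ i : Fin d, (i : ℕ) + 1 = d → 0 < x i

end Cones

/-! ### Geometric realizations -/

/-- The order complex of a poset: its faces are the nonempty finite chains. -/
def orderComplex (P : Type*) [PartialOrder P] : AbstractSimplicialComplex P where
  faces := {s | s.Nonempty ∧ IsChain (· ≤ ·) (s : Set P)}
  isRelLowerSet_faces := fun _ hs =>
    ⟨hs.1, fun _ hts ht => ⟨ht, hs.2.mono (by exact_mod_cast hts)⟩⟩
  singleton_mem := fun v => by simp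

/-- The points of the geometric realization of a simplicial complex, in barycentric coordinates:
nonnegative finitely supported weights on the vertices of total weight `1` whose support is a
face. -/
def GeomRealization {ι : Type*} (K : AbstractSimplicialComplex ι) : Type _ :=
  {x : ι →₀ ℝ // (∀ i, 0 ≤ x i) ∧ (x.sum fun _ a => a) = 1 ∧ x.support ∈ K.faces}

namespace GeomRealization

variable {ι : Type*} {K : AbstractSimplicialComplex ι}

/-- The closed simplex spanned by a finite set `s` of vertices. -/
def closedSimplex (K : AbstractSimplicialComplex ι) (s : Finset ι) : Set (GeomRealization K) :=
  {x | x.1.support ⊆ s}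

/-- The Euclidean topology of a closed simplex, given by its barycentric coordinates. (Only the
finitely many coordinates with index in `s` can be nonzero on it.) -/
abbrev simplexTopology (K : AbstractSimplicialComplex ι) (s : Finset ι) :
    TopologicalSpace (closedSimplex K s) :=
  TopologicalSpace.induced (fun x i => x.1.1 i : closedSimplex K s → ι → ℝ) inferInstance

/-- The weak topology: a set is open if and only if it meets every closed simplex in an open subset
of that simplex. -/
instance : TopologicalSpace (GeomRealization K) :=
  ⨆ s : K.faces, TopologicalSpace.coinduced
    (Subtype.val : closedSimplex K s.1 → GeomRealization K) (simplexTopology K s.1)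

end GeomRealization

/-- The geometric realization of a poset. -/
abbrev PosetRealization (P : Type*) [PartialOrder P] : Type _ := GeomRealization (orderComplex P)

/-! ### Strong deformation retracts -/

/-- `A` is a strong deformation retract of `X`: the identity of `X` is homotopic, relative to `A`,
to a map with values in `A`. -/
def IsStrongDeformationRetract {X : Type*} [TopologicalSpace X] (A : Set X) : Prop :=
  ∃ r : C(X, X), (∀ x, r x ∈ A) ∧ (ContinuousMap.id X).HomotopicRel r A

/-! ### Topology of geometric realizations -/

namespace GeomRealization

variable {ι : Type*} {K : AbstractSimplicialComplex ι}

/-! Once the order is inclusion, the geometry of cones controls the realizations. Part (a) rests on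
`contractibleSpace_of_monotone`: a monotone `g` with `c ≤ g c` and `e ≤ g c` links the identity to a
constant through the map induced by `g`. The zero cone is least in two of the posets, so `g` is the
identity there. On the nonzero cones of `Cones⁺`, `g` adds a fixed ray; positivity of the last
coordinate keeps the sum salient.

For (b), finitely many integer forms `L` cut `ℝ^d` into finitely many rational salient cells. Let
`W` be the finite set of nonzero cones that are unions of cells, and `F ⊆ W` the set of nonzero
cells. After a point `p D` is chosen in the relative interior of each `D` in `F`, every vector is a
unique nonnegative combination of the `p D` over a chain (`exists_chainWeight`,
`chainWeight_unique`), with continuous coefficients (`continuous_coords`). This is the barycentric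
subdivision of a complete fan, and radial projection turns `|F|` into a sphere
(`nonempty_homeomorph_sphere`).

To retract `|W|` onto `|F|`, choose a nonzero `p C` in the other cones as well, send `x` to `∑ x_C p
C`, which is nonzero by salience, and expand it again over the cells. The straight segment from `x`
to its image may leave the realization. Instead, at time `t` only the bottom part of `x`, of mass
`t`, is replaced. Its barycenter lies in every cone `C` of the rest, and `C` is a union of cells, so
the new cells lie in `C` and the support stays a chain (`isChain_deform`).

Rational cones are given by finitely many integer inequalities (`exists_inequalities_of_hull`), so
any finite set of cones consists of unions of cells of one arrangement. Hence the `|W|` are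
directed, cover the space and determine its topology. -/

theorem continuous_coord (i : ι) : Continuous fun x : GeomRealization K => x.1 i := by
  refine continuous_iSup_dom.2 fun s => continuous_coinduced_dom.2 ?_
  let _ := simplexTopology K s.1
  exact (continuous_apply i).comp continuous_induced_dom

/-- The subspace of points supported in a given set of vertices. -/
def supported (K : AbstractSimplicialComplex ι) (V : Set ι) : Set (GeomRealization K) :=
  {x | (x.1.support : Set ι) ⊆ V}

theorem mem_supported {V : Set ι} {x : GeomRealization K} :
    x ∈ supported K V ↔ ∀ i, i ∉ V → x.1 i = 0 := by
  simp only [supported, Set.mem_ofPred_eq, Set.subset_def, Finset.mem_coe, Finsupp.mem_support_iff]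
  exact forall_congr' fun i => not_imp_comm

theorem isClosed_supported (V : Set ι) : IsClosed (supported K V) := by
  have : supported K V = ⋂ i, ⋂ (_ : i ∉ V), {x | x.1 i = 0} := by
    ext x; simp [mem_supported]
  rw [this]
  exact isClosed_iInter fun i => isClosed_iInter fun _ =>
    isClosed_singleton.preimage (continuous_coord i)

/-- A map into a geometric realization whose values are supported in a fixed finite set of vertices
is continuous if its coordinates are. -/
theorem continuous_of_coord {Y : Type*} [TopologicalSpace Y] {f : Y → GeomRealization K}
    (W : Finset ι) (hW : ∀ y, (f y).1.support ⊆ W)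
    (hf : ∀ i, Continuous fun y => (f y).1 i) : Continuous f := by
  -- The faces inside `W` give a finite closed cover of `Y`; on each piece `f` factors through one
  -- closed simplex.
  let T := {t : Finset ι // t ∈ W.powerset ∧ t ∈ K.faces}
  have : Finite T := Finite.of_injective (fun t : T => (⟨t.1, t.2.1⟩ : W.powerset))
    fun a b h => Subtype.ext (by simpa using h)
  let A : T → Set Y := fun t => {y | (f y).1.support ⊆ t.1}
  refine (locallyFinite_of_finite A).continuous ?_ (fun t => ?_) (fun t => ?_)
  · exact Set.eq_univ_of_forall fun y => Set.mem_iUnion.2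
      ⟨⟨_, Finset.mem_powerset.2 (hW y), (f y).2.2.2⟩, by simp [A]⟩
  · have : A t = ⋂ i, ⋂ (_ : i ∉ t.1), {y | (f y).1 i = 0} := by
      ext y
      simp only [A, Set.mem_ofPred_eq, Finset.subset_iff, Finsupp.mem_support_iff, Set.mem_iInter]
      exact forall_congr' fun i => not_imp_comm
    rw [this]
    exact isClosed_iInter fun i => isClosed_iInter fun _ => isClosed_singleton.preimage (hf i)
  · rw [continuousOn_iff_continuous_domRestrict]
    let _ := simplexTopology K t.1
    have h1 : Continuous (fun y : A t => (⟨f y.1, y.2⟩ : closedSimplex K t.1)) :=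
      continuous_induced_rng.2 (continuous_pi fun i => (hf i).comp continuous_subtype_val)
    have h2 : @Continuous _ _ (simplexTopology K t.1) _
        (Subtype.val : closedSimplex K t.1 → GeomRealization K) :=
      continuous_iff_coinduced_le.2 (le_iSup
        (fun s : K.faces => TopologicalSpace.coinduced
          (Subtype.val : closedSimplex K s.1 → GeomRealization K) (simplexTopology K s.1))
        ⟨t.1, t.2.2⟩)
    exact h2.comp h1

/-- This allows continuity to be tested on the simplices with their subspace topology, since on a
face the Euclidean topology is at least as fine. -/
theorem isCoherentWith_supported :
    Topology.IsCoherentWith ((fun s : Finset ι => supported K s) '' K.faces) := by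
  refine ⟨fun u hu => isOpen_iSup_iff.2 fun s => ?_⟩
  have h := hu _ ⟨s.1, s.2, rfl⟩
  rw [isOpen_coinduced]
  let _ := simplexTopology K s.1
  have h1 : Continuous (fun y : closedSimplex K s.1 =>
      (⟨y.1, by exact_mod_cast y.2⟩ : supported K (s.1 : Set ι))) := by
    refine Continuous.subtype_mk (continuous_of_coord s.1 (fun y => y.2) fun i => ?_) _
    exact (continuous_apply i).comp continuous_induced_dom
  exact h.preimage h1

/-- The product of a geometric realization with a locally compact space carries the topology
determined by the products with closed simplices. -/
theorem continuous_prod {Y Z : Type*} [TopologicalSpace Y] [TopologicalSpace Z]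
    [LocallyCompactSpace Y] {f : Y × GeomRealization K → Z}
    (hf : ∀ s ∈ K.faces, Continuous fun p : Y × supported K (s : Set ι) => f (p.1, p.2)) :
    Continuous f := by
  -- Currying moves the product into the target, where coherence of the realization applies; local
  -- compactness of `Y` permits uncurrying.
  let g : GeomRealization K → C(Y, Z) := fun x => ⟨fun y => f (y, x),
    (hf _ x.2.2.2).comp (Continuous.prodMk_left (⟨x, by simp [supported]⟩ : supported K x.1.support))⟩
  have hg : Continuous g := by
    refine isCoherentWith_supported.continuous_iff.2 ?_
    rintro _ ⟨s, hs, rfl⟩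
    rw [continuousOn_iff_continuous_domRestrict]
    exact (ContinuousMap.curry
      ⟨fun p : supported K (s : Set ι) × Y => f (p.2, p.1), (hf s hs).comp continuous_swap⟩).continuous
  exact (ContinuousMap.continuous_uncurry_of_continuous ⟨g, hg⟩).comp continuous_swap

end GeomRealization

/-! ### Cutting off the bottom part of a weight -/

section LowPart

variable {P : Type*} [PartialOrder P]

open Classical in
/-- The bottom part of mass `t` of a weight `x` on a poset. -/
noncomputable def lowPart (t : ℝ) (x : P →₀ ℝ) : P →₀ ℝ :=
  Finsupp.onFinset x.support
    -- The chain is filled from below: `c` receives what the elements under it leave of `t`, at most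
    -- `x c` and at least `0`.
    (fun c => min (x c) (max 0 (t - ∑ e ∈ x.support with e < c, x e))) fun c hc => by
      rw [Finsupp.mem_support_iff]
      intro h
      simp [h] at hc

open Classical in
-- With the sum over a fixed `W`, the formula is visibly continuous although the support of `x`
-- varies.
theorem lowPart_apply {t : ℝ} {x : P →₀ ℝ} {W : Finset P} (hW : x.support ⊆ W) (c : P) :
    lowPart t x c = min (x c) (max 0 (t - ∑ e ∈ W with e < c, x e)) := by
  have : ∑ e ∈ x.support with e < c, x e = ∑ e ∈ W with e < c, x e := by
    refine Finset.sum_subset (Finset.filter_subset_filter _ hW) fun e he he' => ?_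
    by_contra h
    exact he' (Finset.mem_filter.2 ⟨Finsupp.mem_support_iff.2 h, (Finset.mem_filter.1 he).2⟩)
  rw [← this]
  rfl

theorem lowPart_le (t : ℝ) (x : P →₀ ℝ) (c : P) : lowPart t x c ≤ x c := min_le_left _ _

theorem lowPart_nonneg (t : ℝ) {x : P →₀ ℝ} (hx : ∀ c, 0 ≤ x c) (c : P) : 0 ≤ lowPart t x c :=
  le_min (hx c) (le_max_left _ _)

theorem support_lowPart_subset (t : ℝ) (x : P →₀ ℝ) : (lowPart t x).support ⊆ x.support :=
  Finsupp.support_onFinset_subset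

theorem support_sub_lowPart_subset (t : ℝ) (x : P →₀ ℝ) :
    (x - lowPart t x).support ⊆ x.support := by
  classical
  exact (Finsupp.support_sub).trans (Finset.union_subset subset_rfl (support_lowPart_subset t x))

theorem lowPart_zero {x : P →₀ ℝ} (hx : ∀ c, 0 ≤ x c) : lowPart 0 x = 0 := by
  classical
  ext c
  rw [lowPart_apply subset_rfl, max_eq_left]
  · simpa using hx c
  · simpa using Finset.sum_nonneg fun e _ => hx e

theorem lowPart_one {x : P →₀ ℝ} (hx : ∀ c, 0 ≤ x c) (h1 : (x.sum fun _ a => a) = 1) :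
    lowPart 1 x = x := by
  classical
  ext c
  rw [lowPart_apply subset_rfl]
  refine min_eq_left (le_max_of_le_right ?_)
  rw [le_sub_iff_add_le, ← h1, Finsupp.sum]
  by_cases hc : c ∈ x.support
  · rw [← Finset.sum_insert (by simp)]
    refine Finset.sum_le_sum_of_subset_of_nonneg ?_ fun i _ _ => hx i
    exact Finset.insert_subset hc (Finset.filter_subset _ _)
  · rw [Finsupp.notMem_support_iff.1 hc, zero_add]
    exact Finset.sum_le_sum_of_subset_of_nonneg (Finset.filter_subset _ _) fun i _ _ => hx i

/-- The bottom part of a weight on a chain lies below the rest. -/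
theorem le_of_mem_support_lowPart {t : ℝ} {x : P →₀ ℝ} (hx : ∀ c, 0 ≤ x c)
    (hch : IsChain (· ≤ ·) (x.support : Set P)) {c e : P} (he : e ∈ (lowPart t x).support)
    (hc : c ∈ (x - lowPart t x).support) : e ≤ c := by
  classical
  have hex := support_lowPart_subset t x he
  have hcx := support_sub_lowPart_subset t x hc
  rcases hch.total hex hcx with h | h
  · exact h
  rcases h.eq_or_lt with h | h
  · exact h.ge
  exfalso
  rw [Finsupp.mem_support_iff, lowPart_apply subset_rfl] at he
  rw [Finsupp.mem_support_iff, Finsupp.sub_apply, lowPart_apply subset_rfl] at hc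
  set a := ∑ i ∈ x.support with i < e, x i
  set b := ∑ i ∈ x.support with i < c, x i
  have hab : x c + b ≤ a := by
    rw [← Finset.sum_insert (by simp)]
    refine Finset.sum_le_sum_of_subset_of_nonneg ?_ fun i _ _ => hx i
    refine Finset.insert_subset (Finset.mem_filter.2 ⟨hcx, h⟩) fun i hi => ?_
    simp only [Finset.mem_filter] at hi ⊢
    exact ⟨hi.1, hi.2.trans h⟩
  -- As `e` receives mass, `t` exceeds everything below `e`; this includes all of `x c`, so nothing
  -- of `c` is left over.
  have h1 : a < t := by
    by_contra hta
    rw [max_eq_left (by linarith), min_eq_right (hx e)] at he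
    exact he rfl
  rw [min_eq_left (le_max_of_le_right (by linarith)), sub_self] at hc
  exact hc rfl

/-- Continuity of the bottom part on weights supported in a finite set. -/
theorem continuous_lowPart_apply {Y : Type*} [TopologicalSpace Y] {t : Y → ℝ} (ht : Continuous t)
    {x : Y → P →₀ ℝ} (hx : ∀ c, Continuous fun y => x y c) (W : Finset P)
    (hW : ∀ y, (x y).support ⊆ W) (c : P) : Continuous fun y => lowPart (t y) (x y) c := by
  classical
  simp only [lowPart_apply (hW _)]
  fun_prop

end LowPart

/-! ### Contractible posets -/

theorem Finsupp.mapDomain_eq_sum_ite {α β : Type*} [DecidableEq β] (g : α → β) {z : α →₀ ℝ}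
    {s : Finset α} (hs : z.support ⊆ s) (b : β) :
    z.mapDomain g b = ∑ a ∈ s, if g a = b then z a else 0 := by
  rw [Finsupp.mapDomain, Finsupp.sum_of_support_subset _ hs _ (by simp), Finsupp.finsetSum_apply]
  simp [Finsupp.single_apply]

theorem Finsupp.mapDomain_apply_nonneg {α β : Type*} (g : α → β) {z : α →₀ ℝ} (hz : ∀ a, 0 ≤ z a)
    (b : β) : 0 ≤ z.mapDomain g b := by
  classical
  rw [Finsupp.mapDomain_eq_sum_ite g subset_rfl]
  exact Finset.sum_nonneg fun a _ => by split_ifs <;> simp [hz]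

theorem Finsupp.sum_id_add {α : Type*} (y z : α →₀ ℝ) :
    ((y + z).sum fun _ a => a) = (y.sum fun _ a => a) + z.sum fun _ a => a :=
  Finsupp.sum_add_index' (by simp) (by simp)

theorem Finsupp.sum_id_mapDomain {α β : Type*} (g : α → β) (z : α →₀ ℝ) :
    ((z.mapDomain g).sum fun _ a => a) = z.sum fun _ a => a :=
  Finsupp.sum_mapDomain_index (by simp) (by simp)

theorem Finsupp.sum_id_smul {α : Type*} (t : ℝ) (z : α →₀ ℝ) :
    ((t • z).sum fun _ a => a) = t * z.sum fun _ a => a := by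
  rw [Finsupp.sum_smul_index' (by simp), Finsupp.mul_sum]
  rfl

namespace PosetRealization

open unitInterval

variable {P : Type*} [PartialOrder P]

/-- The point with given barycentric coordinates. -/
def ofWeight (z : P →₀ ℝ) (h0 : ∀ c, 0 ≤ z c) (h1 : (z.sum fun _ a => a) = 1)
    (hc : IsChain (· ≤ ·) (z.support : Set P)) : PosetRealization P :=
  ⟨z, h0, h1, by
    rw [Finsupp.support_nonempty_iff]
    rintro rfl
    simp at h1, hc⟩

/-- The vertex of the realization at an element of the poset. -/
noncomputable def vertex (e : P) : PosetRealization P :=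
  ofWeight (Finsupp.single e 1)
    (fun c => by classical rw [Finsupp.single_apply]; split_ifs <;> norm_num)
    (by simp) fun a ha b hb h => (h ((Finset.mem_singleton.1
      (Finsupp.support_single_subset ha)).trans (Finset.mem_singleton.1
        (Finsupp.support_single_subset hb)).symm)).elim

theorem isChain_support (x : PosetRealization P) : IsChain (· ≤ ·) (x.1.support : Set P) :=
  x.2.2.2.2

section LowHigh

variable {g : P → P} (hg : Monotone g) (hle : ∀ c, c ≤ g c)

/-- The bottom part of mass `t` of `x` stays and the rest is moved by `g`. -/
noncomputable def lowHigh (t : ℝ) (x : PosetRealization P) : PosetRealization P :=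
  ofWeight (lowPart t x.1 + (x.1 - lowPart t x.1).mapDomain g)
    (fun c => add_nonneg (lowPart_nonneg t x.2.1 c) (Finsupp.mapDomain_apply_nonneg g
      (fun a => sub_nonneg.2 (lowPart_le t x.1 a)) c))
    (by rw [Finsupp.sum_id_add, Finsupp.sum_id_mapDomain, ← Finsupp.sum_id_add, add_sub_cancel]
        exact x.2.2.1) <| by
    classical
    have hch := isChain_support x
    intro a ha b hb _
    have hcases : ∀ a ∈ (lowPart t x.1 + (x.1 - lowPart t x.1).mapDomain g).support,
        a ∈ (lowPart t x.1).support ∨ ∃ c ∈ (x.1 - lowPart t x.1).support, g c = a := by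
      intro a ha
      rcases Finset.mem_union.1 (Finsupp.support_add ha) with h | h
      · exact Or.inl h
      · exact Or.inr (Finset.mem_image.1 (Finsupp.mapDomain_support h))
    have key : ∀ {a c}, a ∈ (lowPart t x.1).support → c ∈ (x.1 - lowPart t x.1).support →
        a ≤ g c := fun ha hc => (le_of_mem_support_lowPart x.2.1 hch ha hc).trans (hle _)
    rcases hcases a ha with h | ⟨c, hc, rfl⟩ <;> rcases hcases b hb with h' | ⟨c', hc', rfl⟩
    · exact hch.total (support_lowPart_subset _ _ h) (support_lowPart_subset _ _ h')
    · exact Or.inl (key h hc')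
    · exact Or.inr (key h' hc)
    · exact (hch.total (support_sub_lowPart_subset _ _ hc)
        (support_sub_lowPart_subset _ _ hc')).imp (fun h => hg h) (fun h => hg h)

theorem coe_lowHigh_zero (x : PosetRealization P) :
    (lowHigh hg hle 0 x).1 = x.1.mapDomain g := by
  change lowPart 0 x.1 + (x.1 - lowPart 0 x.1).mapDomain g = _
  rw [lowPart_zero x.2.1, zero_add, sub_zero]

theorem lowHigh_one (x : PosetRealization P) : lowHigh hg hle 1 x = x := Subtype.ext <| by
  change lowPart 1 x.1 + (x.1 - lowPart 1 x.1).mapDomain g = _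
  rw [lowPart_one x.2.1 x.2.2.1, sub_self, Finsupp.mapDomain_zero, add_zero]

theorem continuous_lowHigh :
    Continuous fun p : I × PosetRealization P => lowHigh hg hle p.1 p.2 := by
  classical
  refine GeomRealization.continuous_prod fun s _ => ?_
  have hs : ∀ p : I × GeomRealization.supported (orderComplex P) (s : Set P),
      p.2.1.1.support ⊆ s := fun p => by exact_mod_cast p.2.2
  have hlow : ∀ c, Continuous fun p : I × GeomRealization.supported (orderComplex P) (s : Set P) =>
      lowPart p.1 p.2.1.1 c := continuous_lowPart_apply (by fun_prop)
    (fun c => (GeomRealization.continuous_coord c).comp (by fun_prop)) s hs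
  refine GeomRealization.continuous_of_coord (s ∪ s.image g) (fun p => ?_) fun i => ?_
  · refine Finsupp.support_add.trans (Finset.union_subset_union ?_ ?_)
    · exact (support_lowPart_subset _ _).trans (hs p)
    · exact Finsupp.mapDomain_support.trans
        (Finset.image_subset_image ((support_sub_lowPart_subset _ _).trans (hs p)))
  · change Continuous fun p : I × GeomRealization.supported (orderComplex P) (s : Set P) =>
      lowPart p.1 p.2.1.1 i + (p.2.1.1 - lowPart p.1 p.2.1.1).mapDomain g i
    simp only [Finsupp.mapDomain_eq_sum_ite g ((support_sub_lowPart_subset _ _).trans (hs _))]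
    refine (hlow i).add (continuous_finsetSum _ fun c _ => ?_)
    split_ifs
    · exact ((GeomRealization.continuous_coord c).comp (by fun_prop)).sub (hlow c)
    · exact continuous_const

end LowHigh

section Join

variable {g : P → P} (hg : Monotone g) {e : P} (he : ∀ c, e ≤ g c)

/-- The point dividing the segment from the image of `x` under `g` to the vertex `e`. -/
noncomputable def segmentTo (t : I) (x : PosetRealization P) : PosetRealization P :=
  ofWeight ((1 - t : ℝ) • x.1.mapDomain g + (t : ℝ) • Finsupp.single e 1)
    (fun c => by
      classical
      refine add_nonneg (mul_nonneg (sub_nonneg.2 t.2.2)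
        (Finsupp.mapDomain_apply_nonneg g x.2.1 c)) (mul_nonneg t.2.1 ?_)
      rw [Finsupp.single_apply]
      split_ifs <;> norm_num)
    (by
      rw [Finsupp.sum_id_add, Finsupp.sum_id_smul, Finsupp.sum_id_smul, Finsupp.sum_id_mapDomain,
        Finsupp.sum_single_index rfl, x.2.2.1]
      ring) <| by
    classical
    intro a ha b hb _
    have hcases : ∀ a ∈ ((1 - t : ℝ) • x.1.mapDomain g + (t : ℝ) • Finsupp.single e 1).support,
        a = e ∨ ∃ c ∈ x.1.support, g c = a := by
      intro a ha
      rcases Finset.mem_union.1 (Finsupp.support_add ha) with h | h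
      · exact Or.inr (Finset.mem_image.1 (Finsupp.mapDomain_support (Finsupp.support_smul h)))
      · exact Or.inl (Finset.mem_singleton.1
          (Finsupp.support_single_subset (Finsupp.support_smul h)))
    rcases hcases a ha with rfl | ⟨c, hc, rfl⟩ <;> rcases hcases b hb with rfl | ⟨c', hc', rfl⟩
    · exact Or.inl le_rfl
    · exact Or.inl (he _)
    · exact Or.inr (he _)
    · exact ((isChain_support x).total hc hc').imp (fun h => hg h) (fun h => hg h)

theorem coe_segmentTo_zero (x : PosetRealization P) :
    (segmentTo hg he 0 x).1 = x.1.mapDomain g := by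
  simp [segmentTo]
  rfl

theorem segmentTo_one (x : PosetRealization P) : segmentTo hg he 1 x = vertex e :=
  Subtype.ext <| by simp [segmentTo]; rfl

theorem continuous_segmentTo :
    Continuous fun p : I × PosetRealization P => segmentTo hg he p.1 p.2 := by
  classical
  refine GeomRealization.continuous_prod fun s _ => ?_
  have hs : ∀ p : I × GeomRealization.supported (orderComplex P) (s : Set P),
      p.2.1.1.support ⊆ s := fun p => by exact_mod_cast p.2.2
  refine GeomRealization.continuous_of_coord (s.image g ∪ {e}) (fun p => ?_) fun i => ?_
  · refine Finsupp.support_add.trans (Finset.union_subset_union ?_ ?_)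
    · exact Finsupp.support_smul.trans (Finsupp.mapDomain_support.trans
        (Finset.image_subset_image (hs p)))
    · exact Finsupp.support_smul.trans Finsupp.support_single_subset
  · change Continuous fun p : I × GeomRealization.supported (orderComplex P) (s : Set P) =>
      (1 - p.1 : ℝ) * p.2.1.1.mapDomain g i + (p.1 : ℝ) * Finsupp.single e (1 : ℝ) i
    simp only [Finsupp.mapDomain_eq_sum_ite g (hs _)]
    refine (Continuous.mul (by fun_prop) (continuous_finsetSum _ fun c _ => ?_)).add
      (by fun_prop)
    split_ifs
    · exact (GeomRealization.continuous_coord c).comp (by fun_prop)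
    · exact continuous_const

end Join

/-- A poset with a monotone self-map that dominates both the identity and a constant map is
contractible. -/
theorem contractibleSpace_of_monotone {g : P → P} (hg : Monotone g) (hle : ∀ c, c ≤ g c) {e : P}
    (he : ∀ c, e ≤ g c) : ContractibleSpace (PosetRealization P) := by
  rw [contractible_iff_id_nullhomotopic]
  let f : C(PosetRealization P, PosetRealization P) :=
    ⟨fun x => lowHigh hg hle 0 x, by
      simpa only [Function.comp_def, Set.Icc.coe_zero] using
        (continuous_lowHigh hg hle).comp (Continuous.prodMk_right (0 : I))⟩
  -- Splitting off the bottom part keeps supports chains: `c` and `g c'` are compared only when `c ≤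
  -- c' ≤ g c'`.
  have h1 : f.Homotopic (ContinuousMap.id _) :=
    ⟨{ toFun := fun p => lowHigh hg hle p.1 p.2
       continuous_toFun := continuous_lowHigh hg hle
       map_zero_left := fun x => rfl
       map_one_left := lowHigh_one hg hle }⟩
  have h2 : f.Homotopic (ContinuousMap.const _ (vertex e)) :=
    ⟨{ toFun := fun p => segmentTo hg he p.1 p.2
       continuous_toFun := continuous_segmentTo hg he
       map_zero_left := fun x =>
         Subtype.ext ((coe_segmentTo_zero hg he x).trans (coe_lowHigh_zero hg hle x).symm)
       map_one_left := segmentTo_one hg he }⟩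
  exact ⟨vertex e, h1.symm.trans h2⟩

theorem contractibleSpace_of_forall_le {e : P} (he : ∀ c, e ≤ c) :
    ContractibleSpace (PosetRealization P) :=
  contractibleSpace_of_monotone monotone_id (fun _ => le_rfl) he

end PosetRealization

/-! ### Contractibility of the posets of cones -/

namespace Cones

variable {d : ℕ}

theorem OrderIsInclusion.le_iff (h : OrderIsInclusion d) {C D : Cones d} :
    C ≤ D ↔ C.toCone ≤ D.toCone := h C D

theorem zero_le' (h : OrderIsInclusion d) (C : Cones d) : 0 ≤ C :=
  h.le_iff.2 (bot_le : (⊥ : PointedCone ℝ (Fin d → ℝ)) ≤ _)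

theorem isPlus_zero : (0 : Cones d).IsPlus := fun x hx hx0 =>
  absurd (by simpa using (show x ∈ (⊥ : PointedCone ℝ (Fin d → ℝ)) from hx)) hx0

theorem ne_zero_iff {C : Cones d} : C ≠ 0 ↔ ∃ x ∈ C.toCone, x ≠ 0 := by
  constructor
  · intro h
    by_contra! h'
    exact h (Cones.ext ((Submodule.eq_bot_iff _).2 h'))
  · rintro ⟨x, hx, hx0⟩ rfl
    exact hx0 (by simpa using (show x ∈ (⊥ : PointedCone ℝ (Fin d → ℝ)) from hx))

theorem salient_of_pos {C : PointedCone ℝ (Fin d → ℝ)} {i : Fin d}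
    (h : ∀ x ∈ C, x ≠ 0 → 0 < x i) (x : Fin d → ℝ) (hx : x ∈ C) (hx' : -x ∈ C) : x = 0 := by
  by_contra h0
  have h1 := h x hx h0
  have h2 := h _ hx' (neg_ne_zero.2 h0)
  simp only [Pi.neg_apply] at h2
  linarith

theorem exists_isPlus_ne_zero (i : Fin d) (hi : (i : ℕ) + 1 = d) :
    ∃ C : Cones d, C.IsPlus ∧ C ≠ 0 := by
  have hv : latticeVec (Pi.single i 1 : Fin d → ℤ) = Pi.single i 1 := by
    ext j; by_cases h : j = i <;> simp [latticeVec, h]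
  have hpos : ∀ x ∈ PointedCone.hull ℝ {(Pi.single i 1 : Fin d → ℝ)}, x ≠ 0 → 0 < x i := by
    intro x hx hx0
    obtain ⟨a, rfl⟩ := Submodule.mem_span_singleton.1 hx
    have ha : a ≠ 0 := by rintro rfl; simp at hx0
    simpa [NNReal.smul_def] using pos_iff_ne_zero.2 ha
  let C : Cones d :=
    { toCone := PointedCone.hull ℝ {(Pi.single i 1 : Fin d → ℝ)}
      rational := ⟨{Pi.single i 1}, by simp [hv]⟩
      salient := salient_of_pos hpos }
  refine ⟨C, fun x hx hx0 j hj => ?_, ne_zero_iff.2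
    ⟨Pi.single i 1, Submodule.subset_span rfl, by simp⟩⟩
  obtain rfl : j = i := Fin.ext (by omega)
  exact hpos x hx hx0

/-- The join of two cones in `(ℝ^(d-1) × ℝ_{>0}) ∪ {0}` is their Minkowski sum. -/
theorem IsPlus.exists_sup {C D : Cones d} (hC : C.IsPlus) (hD : D.IsPlus) (i : Fin d)
    (hi : (i : ℕ) + 1 = d) : ∃ E : Cones d, E.IsPlus ∧ E.toCone = C.toCone ⊔ D.toCone := by
  classical
  have hpos : ∀ x ∈ C.toCone ⊔ D.toCone, x ≠ 0 → 0 < x i := by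
    intro x hx hx0
    obtain ⟨y, hy, z, hz, rfl⟩ := Submodule.mem_sup.1 hx
    rcases eq_or_ne y 0 with rfl | hy0
    · simpa using hD z hz (by simpa using hx0) i hi
    rcases eq_or_ne z 0 with rfl | hz0
    · simpa using hC y hy hy0 i hi
    exact add_pos (hC y hy hy0 i hi) (hD z hz hz0 i hi)
  obtain ⟨s, hs⟩ := C.rational
  obtain ⟨t, ht⟩ := D.rational
  refine ⟨⟨C.toCone ⊔ D.toCone, ⟨s ∪ t, ?_⟩, salient_of_pos hpos⟩, fun x hx hx0 j hj => ?_, rfl⟩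
  · rw [hs, ht, Finset.coe_union, Set.image_union, PointedCone.hull, PointedCone.hull,
      PointedCone.hull, Submodule.span_union]
  · obtain rfl : j = i := Fin.ext (by omega)
    exact hpos x hx hx0

theorem contractibleSpace_cones (h : OrderIsInclusion d) :
    ContractibleSpace (PosetRealization (Cones d)) :=
  PosetRealization.contractibleSpace_of_forall_le (zero_le' h)

theorem contractibleSpace_isPlus (h : OrderIsInclusion d) :
    ContractibleSpace (PosetRealization {C : Cones d // C.IsPlus}) :=
  PosetRealization.contractibleSpace_of_forall_le
    (e := ⟨0, isPlus_zero⟩) fun C => zero_le' h C.1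

/-- The map `C ↦ C + e`, with `e` a fixed nonzero cone of the poset, is monotone and dominates both
`C` and `e`. -/
theorem contractibleSpace_isPlus_ne_zero (hd : 1 ≤ d) (h : OrderIsInclusion d) :
    ContractibleSpace (PosetRealization {C : Cones d // C.IsPlus ∧ C ≠ 0}) := by
  let i : Fin d := ⟨d - 1, by omega⟩
  have hi : (i : ℕ) + 1 = d := by simp only [i]; omega
  obtain ⟨e, he, he0⟩ := exists_isPlus_ne_zero i hi
  choose f hf hf' using fun C : {C : Cones d // C.IsPlus ∧ C ≠ 0} => C.2.1.exists_sup he i hi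
  have hle : ∀ C, C.1 ≤ f C := fun C => h.le_iff.2 (by rw [hf']; exact le_sup_left)
  let g : {C : Cones d // C.IsPlus ∧ C ≠ 0} → {C : Cones d // C.IsPlus ∧ C ≠ 0} :=
    fun C => ⟨f C, hf C, by
      obtain ⟨x, hx, hx0⟩ := ne_zero_iff.1 C.2.2
      exact ne_zero_iff.2 ⟨x, h.le_iff.1 (hle C) hx, hx0⟩⟩
  refine PosetRealization.contractibleSpace_of_monotone (g := g) (fun C D hCD => h.le_iff.2 ?_)
    hle (e := ⟨e, he, he0⟩) fun C => h.le_iff.2 ?_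
  · simp only [g, hf']
    exact sup_le_sup_right (h.le_iff.1 hCD) _
  · simp only [g, hf']
    exact le_sup_right

end Cones

/-! ### The theorem of Weyl and Minkowski for rational cones -/

open scoped Matrix

section WeylMinkowski

variable {d : ℕ}

theorem latticeVec_dotProduct (x y : Fin d → ℤ) :
    latticeVec x ⬝ᵥ latticeVec y = ((x ⬝ᵥ y : ℤ) : ℝ) := by
  simp [dotProduct, latticeVec]

theorem latticeVec_add (x y : Fin d → ℤ) : latticeVec (x + y) = latticeVec x + latticeVec y := by
  ext; simp [latticeVec]

theorem latticeVec_smul (n : ℤ) (x : Fin d → ℤ) : latticeVec (n • x) = (n : ℝ) • latticeVec x := by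
  ext; simp [latticeVec]

theorem latticeVec_single (i : Fin d) (n : ℤ) :
    latticeVec (Pi.single i n) = Pi.single i (n : ℝ) := by
  ext j; by_cases h : j = i <;> simp [latticeVec, h]

theorem PointedCone.dotProduct_nonneg_of_mem_hull {s : Set (Fin d → ℝ)} {w y : Fin d → ℝ}
    (hw : ∀ x ∈ s, 0 ≤ w ⬝ᵥ x) (hy : y ∈ PointedCone.hull ℝ s) : 0 ≤ w ⬝ᵥ y := by
  induction hy using Submodule.span_induction with
  | mem x hx => exact hw x hx
  | zero => simp
  | add x y _ _ hx hy => rw [dotProduct_add]; exact add_nonneg hx hy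
  | smul a x _ hx =>
    change 0 ≤ w ⬝ᵥ ((a : ℝ) • x)
    rw [dotProduct_smul]
    exact mul_nonneg a.2 hx

/-- Fourier–Motzkin elimination: the conic hull of finitely many integer vectors is cut out by
finitely many integer inequalities. -/
theorem exists_inequalities_of_hull (s : Finset (Fin d → ℤ)) :
    ∃ L : Finset (Fin d → ℤ), ∀ y, y ∈ PointedCone.hull ℝ (latticeVec '' (s : Set (Fin d → ℤ))) ↔
      ∀ l ∈ L, 0 ≤ latticeVec l ⬝ᵥ y := by
  classical
  induction s using Finset.induction_on with
  | empty =>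
    refine ⟨Finset.univ.image (fun i => Pi.single i 1) ∪
      Finset.univ.image (fun i => Pi.single i (-1)), fun y => ?_⟩
    simp only [Finset.coe_empty, Set.image_empty, PointedCone.hull, Submodule.span_empty,
      Submodule.mem_bot]
    constructor
    · rintro rfl; simp
    · intro h
      ext i
      have h1 := h (Pi.single i 1) (by simp)
      have h2 := h (Pi.single i (-1)) (by simp)
      simp only [latticeVec_single, single_dotProduct] at h1 h2
      push_cast at h1 h2
      simp only [Pi.zero_apply]
      linarith
  | insert x s _ ih =>
    obtain ⟨L, hL⟩ := ih
    let c : (Fin d → ℤ) → ℝ := fun l => latticeVec l ⬝ᵥ latticeVec x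
    let pos := L.filter fun l => 0 < l ⬝ᵥ x
    let neg := L.filter fun l => l ⬝ᵥ x < 0
    have hpos : ∀ l, l ∈ pos ↔ l ∈ L ∧ 0 < c l := fun l => by
      simp only [pos, c, Finset.mem_filter, latticeVec_dotProduct, Int.cast_pos]
    have hneg : ∀ l, l ∈ neg ↔ l ∈ L ∧ c l < 0 := fun l => by
      simp only [neg, c, Finset.mem_filter, latticeVec_dotProduct, Int.cast_lt_zero]
    -- Membership of `y` means that some `a ≥ 0` satisfies `a * c l ≤ l ⬝ᵥ y` for all `l ∈ L`. Forms
    -- in `neg` bound `a` below, forms in `pos` bound it above; the combination of such a pair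
    -- vanishes at `x` and compares the two bounds.
    refine ⟨L.filter (fun l => 0 ≤ l ⬝ᵥ x) ∪
      Finset.image₂ (fun p n => (-(n ⬝ᵥ x)) • p + (p ⬝ᵥ x) • n) pos neg, fun y => ?_⟩
    have hcomb : ∀ (p n : Fin d → ℤ) (y : Fin d → ℝ),
        latticeVec ((-(n ⬝ᵥ x)) • p + (p ⬝ᵥ x) • n) ⬝ᵥ y =
          -c n * (latticeVec p ⬝ᵥ y) + c p * (latticeVec n ⬝ᵥ y) := by
      intro p n y
      rw [latticeVec_add, latticeVec_smul, latticeVec_smul, add_dotProduct, smul_dotProduct,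
        smul_dotProduct]
      simp only [c, latticeVec_dotProduct, Int.cast_neg, smul_eq_mul]
    rw [Finset.coe_insert, Set.image_insert_eq, PointedCone.hull, Submodule.mem_span_insert]
    constructor
    · rintro ⟨a, z, hz, rfl⟩ l hl
      have ha : 0 ≤ (a : ℝ) := a.2
      have hax : a • latticeVec x = (a : ℝ) • latticeVec x := rfl
      rw [hax]
      have hz' := (hL z).1 hz
      rcases Finset.mem_union.1 hl with hl | hl
      · rw [Finset.mem_filter] at hl
        have : 0 ≤ c l := by simp only [c, latticeVec_dotProduct]; exact_mod_cast hl.2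
        rw [dotProduct_add, dotProduct_smul]
        exact add_nonneg (mul_nonneg ha this) (hz' l hl.1)
      · obtain ⟨p, hp, n, hn, rfl⟩ := Finset.mem_image₂.1 hl
        rw [hpos] at hp
        rw [hneg] at hn
        rw [hcomb]
        simp only [dotProduct_add, dotProduct_smul]
        have h1 := mul_nonneg (neg_nonneg.2 hn.2.le) (hz' p hp.1)
        have h2 := mul_nonneg hp.2.le (hz' n hn.1)
        change 0 ≤ -c n * (a * c p + latticeVec p ⬝ᵥ z) + c p * (a * c n + latticeVec n ⬝ᵥ z)
        linarith
    · intro h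
      have hfil : ∀ l ∈ L, 0 ≤ c l → 0 ≤ latticeVec l ⬝ᵥ y := fun l hl hcl => by
        refine h l (Finset.mem_union_left _ (Finset.mem_filter.2 ⟨hl, ?_⟩))
        simp only [c, latticeVec_dotProduct] at hcl
        exact_mod_cast hcl
      have hpn : ∀ p ∈ pos, ∀ n ∈ neg,
          0 ≤ -c n * (latticeVec p ⬝ᵥ y) + c p * (latticeVec n ⬝ᵥ y) := fun p hp n hn => by
        rw [← hcomb]
        exact h _ (Finset.mem_union_right _ (Finset.mem_image₂_of_mem hp hn))
      have key : ∃ a : ℝ, 0 ≤ a ∧ ∀ l ∈ L, a * c l ≤ latticeVec l ⬝ᵥ y := by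
        have hneg' : ∀ a : ℝ, ∀ n ∈ neg, (latticeVec n ⬝ᵥ y) / c n ≤ a →
            a * c n ≤ latticeVec n ⬝ᵥ y := fun a n hn ha =>
          (div_le_iff_of_neg ((hneg n).1 hn).2).1 ha
        by_cases hall : ∀ n ∈ neg, (latticeVec n ⬝ᵥ y) / c n ≤ 0
        · refine ⟨0, le_rfl, fun l hl => ?_⟩
          rcases le_or_gt 0 (c l) with hcl | hcl
          · simpa using hfil l hl hcl
          · exact hneg' 0 l ((hneg l).2 ⟨hl, hcl⟩) (hall l ((hneg l).2 ⟨hl, hcl⟩))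
        · push Not at hall
          obtain ⟨n₀, hn₀, hpos₀⟩ := hall
          -- The largest lower bound serves as `a`; by assumption in this case it is positive.
          obtain ⟨n, hn, hmax⟩ := neg.exists_max_image (fun n => (latticeVec n ⬝ᵥ y) / c n) ⟨n₀, hn₀⟩
          refine ⟨(latticeVec n ⬝ᵥ y) / c n, (hpos₀.trans_le (hmax n₀ hn₀)).le, fun l hl => ?_⟩
          rcases lt_trichotomy (c l) 0 with hcl | hcl | hcl
          · exact hneg' _ l ((hneg l).2 ⟨hl, hcl⟩) (hmax l ((hneg l).2 ⟨hl, hcl⟩))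
          · simpa [hcl] using hfil l hl hcl.ge
          · have h1 := hpn l ((hpos l).2 ⟨hl, hcl⟩) n hn
            have hcn := ((hneg n).1 hn).2
            rw [div_mul_eq_mul_div, div_le_iff_of_neg hcn]
            linarith
      obtain ⟨a, ha, haL⟩ := key
      refine ⟨⟨a, ha⟩, y - a • latticeVec x, (hL _).2 fun l hl => ?_, ?_⟩
      · rw [dotProduct_sub, dotProduct_smul, sub_nonneg]
        exact haL l hl
      · change y = a • latticeVec x + _
        simp

/-- The cone cut out by finitely many integer inequalities is the conic hull of finitely many
integer vectors. -/
theorem exists_hull_of_inequalities (L : Finset (Fin d → ℤ)) :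
    ∃ s : Finset (Fin d → ℤ), ∀ y, y ∈ PointedCone.hull ℝ (latticeVec '' (s : Set (Fin d → ℤ))) ↔
      ∀ l ∈ L, 0 ≤ latticeVec l ⬝ᵥ y := by
  -- Biduality: the forms `M` cutting out the hull of `L` generate the dual cone. A form in `N` is
  -- nonnegative on `M`, hence lies in the hull of `L`, hence is nonnegative at every `y` satisfying
  -- the inequalities `L`.
  obtain ⟨M, hM⟩ := exists_inequalities_of_hull L
  obtain ⟨N, hN⟩ := exists_inequalities_of_hull M
  refine ⟨M, fun y => ⟨fun hy l hl => ?_, fun hy => (hN y).2 fun m hm => ?_⟩⟩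
  · refine PointedCone.dotProduct_nonneg_of_mem_hull ?_ hy
    rintro _ ⟨x, hx, rfl⟩
    rw [dotProduct_comm]
    exact (hM _).1 (Submodule.subset_span (Set.mem_image_of_mem _ hl)) x hx
  · rw [dotProduct_comm]
    refine PointedCone.dotProduct_nonneg_of_mem_hull (s := latticeVec '' (L : Set (Fin d → ℤ)))
      ?_ ((hM _).2 fun x hx => ?_)
    · rintro _ ⟨l, hl, rfl⟩
      rw [dotProduct_comm]
      exact hy l hl
    · rw [dotProduct_comm]
      exact (hN _).1 (Submodule.subset_span (Set.mem_image_of_mem _ hx)) m hm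

end WeylMinkowski

/-! ### Barycentric coordinates in a fan of cells -/

section Cells

variable {V : Type*} [NormedAddCommGroup V] [NormedSpace ℝ V]

/-- `y` lies in the smallest cell containing `v` of the arrangement of linear forms `Φ`. -/
def FaceLE (Φ : Finset (Module.Dual ℝ V)) (y v : V) : Prop := ∀ f ∈ Φ, 0 ≤ f v → 0 ≤ f y

theorem FaceLE.refl (Φ : Finset (Module.Dual ℝ V)) (v : V) : FaceLE Φ v v := fun _ _ h => h

theorem FaceLE.trans {Φ : Finset (Module.Dual ℝ V)} {x y z : V} (h : FaceLE Φ x y)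
    (h' : FaceLE Φ y z) : FaceLE Φ x z := fun f hf hz => h f hf (h' f hf hz)

/-- `p` is a choice of a relative interior point in every nonzero cell of the arrangement `Φ`,
the cells being indexed by the poset `F`. -/
structure IsCellSystem {F : Type*} [PartialOrder F] (Φ : Finset (Module.Dual ℝ V)) (p : F → V) :
    Prop where
  neg_mem : ∀ f ∈ Φ, -f ∈ Φ
  separating : ∀ v, (∀ f ∈ Φ, f v = 0) → v = 0
  ne_zero : ∀ D, p D ≠ 0
  le_iff : ∀ D E, D ≤ E ↔ FaceLE Φ (p D) (p E)
  exists_rep : ∀ v ≠ 0, ∃ D, FaceLE Φ v (p D) ∧ FaceLE Φ (p D) v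

/-- A nonnegative weight supported on a chain. -/
def IsChainWeight {F : Type*} [PartialOrder F] (a : F → ℝ) : Prop :=
  (∀ D, 0 ≤ a D) ∧ ∀ D E, a D ≠ 0 → a E ≠ 0 → D ≤ E ∨ E ≤ D

namespace IsChainWeight

variable {F : Type*} [PartialOrder F] {a b : F → ℝ}

theorem mono (ha : IsChainWeight a) (hb : ∀ D, 0 ≤ b D) (hab : ∀ D, b D ≠ 0 → a D ≠ 0) :
    IsChainWeight b := ⟨hb, fun D E hD hE => ha.2 D E (hab D hD) (hab E hE)⟩

theorem zero : IsChainWeight (0 : F → ℝ) := ⟨fun _ => le_rfl, fun _ _ h => absurd rfl h⟩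

theorem smul (ha : IsChainWeight a) {c : ℝ} (hc : 0 ≤ c) : IsChainWeight (c • a) :=
  ha.mono (fun D => mul_nonneg hc (ha.1 D)) fun _ hD => right_ne_zero_of_mul hD

theorem exists_top [Finite F] (ha : IsChainWeight a) (h0 : a ≠ 0) :
    ∃ D, 0 < a D ∧ ∀ E, a E ≠ 0 → E ≤ D := by
  obtain ⟨D₀, hD₀⟩ := Function.ne_iff.1 h0
  obtain ⟨D, hD, hmax⟩ := (Set.toFinite {D | a D ≠ 0}).exists_maximal ⟨D₀, hD₀⟩
  refine ⟨D, (ha.1 D).lt_of_ne' hD, fun E hE => ?_⟩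
  exact (ha.2 E D hE hD).elim id fun h => hmax hE h

theorem isClosed_setOf : IsClosed {a : F → ℝ | IsChainWeight a} := by
  have : {a : F → ℝ | IsChainWeight a} = (⋂ D, {a | 0 ≤ a D}) ∩
      ⋂ D, ⋂ E, ⋂ (_ : ¬ (D ≤ E ∨ E ≤ D)), {a | a D * a E = 0} := by
    ext a
    simp only [IsChainWeight, Set.mem_inter_iff, Set.mem_iInter, Set.mem_ofPred_eq, mul_eq_zero]
    refine and_congr_right fun _ => forall_congr' fun D => forall_congr' fun E => ?_
    tauto
  rw [this]
  refine (isClosed_iInter fun D => isClosed_le continuous_const (continuous_apply D)).inter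
    (isClosed_iInter fun D => isClosed_iInter fun E => isClosed_iInter fun _ =>
      isClosed_eq ((continuous_apply D).mul (continuous_apply E)) continuous_const)

end IsChainWeight

namespace IsCellSystem

variable {F : Type*} [PartialOrder F] {Φ : Finset (Module.Dual ℝ V)} {p : F → V}
  (h : IsCellSystem Φ p)
include h

theorem eq_of_faceLE {D E : F} (h1 : FaceLE Φ (p D) (p E)) (h2 : FaceLE Φ (p E) (p D)) : D = E :=
  le_antisymm ((h.le_iff _ _).2 h1) ((h.le_iff _ _).2 h2)

theorem eq_zero_of_faceLE_zero {v : V} (hv : FaceLE Φ v 0) : v = 0 := by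
  refine h.separating v fun f hf => le_antisymm ?_ (hv f hf (by simp))
  simpa using hv _ (h.neg_mem f hf) (by simp)

theorem faceLE_nonpos {y v : V} (hyv : FaceLE Φ y v) {f : Module.Dual ℝ V} (hf : f ∈ Φ)
    (hv : f v ≤ 0) : f y ≤ 0 := by
  simpa using hyv _ (h.neg_mem f hf) (by simpa using hv)

variable [Fintype F]

/-- The top of the support of a chain weight spans the cell of its barycenter. -/
theorem faceLE_sum {a : F → ℝ} (ha : IsChainWeight a) {D : F} (hD : 0 < a D)
    (htop : ∀ E, a E ≠ 0 → E ≤ D) :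
    FaceLE Φ (∑ E, a E • p E) (p D) ∧ FaceLE Φ (p D) (∑ E, a E • p E) := by
  have hle : ∀ E, a E ≠ 0 → FaceLE Φ (p E) (p D) := fun E hE => (h.le_iff _ _).1 (htop E hE)
  constructor
  · intro f hf hfD
    rw [map_sum]
    refine Finset.sum_nonneg fun E _ => ?_
    rw [map_smul, smul_eq_mul]
    by_cases hE : a E = 0
    · simp [hE]
    · exact mul_nonneg (ha.1 E) (hle E hE f hf hfD)
  · intro f hf
    contrapose!
    intro hfD
    rw [map_sum]
    refine Finset.sum_neg' (fun E _ => ?_) ⟨D, Finset.mem_univ _, ?_⟩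
    · rw [map_smul, smul_eq_mul]
      by_cases hE : a E = 0
      · simp [hE]
      · exact mul_nonpos_of_nonneg_of_nonpos (ha.1 E) (h.faceLE_nonpos (hle E hE) hf hfD.le)
    · rw [map_smul, smul_eq_mul]
      exact mul_neg_of_pos_of_neg hD hfD

theorem faceLE_of_ne_zero {a : F → ℝ} (ha : IsChainWeight a) {E : F} (hE : a E ≠ 0) :
    FaceLE Φ (p E) (∑ D, a D • p D) := by
  obtain ⟨D, hD, htop⟩ := ha.exists_top (fun h0 => hE (congrFun h0 E))
  exact ((h.le_iff _ _).1 (htop E hE)).trans (h.faceLE_sum ha hD htop).2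

/-- If the sum vanished, the point of the top cell would lie in the cell of `0`, which is zero. -/
theorem sum_ne_zero {a : F → ℝ} (ha : IsChainWeight a) (h0 : a ≠ 0) : ∑ D, a D • p D ≠ 0 := by
  intro hs
  obtain ⟨D, hD, htop⟩ := ha.exists_top h0
  have h1 := (h.faceLE_sum ha hD htop).2
  rw [hs] at h1
  exact h.ne_zero D (h.eq_zero_of_faceLE_zero h1)

/-- Removing the pointwise minimum leaves weights with disjoint supports and equal barycenters. If
they are nonzero, the top of each spans the cell of that barycenter, so the tops coincide,
contradicting disjointness. -/
theorem chainWeight_unique {a b : F → ℝ} (ha : IsChainWeight a) (hb : IsChainWeight b)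
    (hab : ∑ D, a D • p D = ∑ D, b D • p D) : a = b := by
  let c : F → ℝ := fun D => min (a D) (b D)
  have hac : IsChainWeight (a - c) := ha.mono (fun D => sub_nonneg.2 (min_le_left _ _))
    fun D hD h0 => hD (by simp [c, h0, hb.1 D])
  have hbc : IsChainWeight (b - c) := hb.mono (fun D => sub_nonneg.2 (min_le_right _ _))
    fun D hD h0 => hD (by simp [c, h0, ha.1 D])
  have hs : ∑ D, (a - c) D • p D = ∑ D, (b - c) D • p D := by
    simp only [Pi.sub_apply, sub_smul, Finset.sum_sub_distrib, hab]
  have hdisj : ∀ D, (a - c) D = 0 ∨ (b - c) D = 0 := fun D => by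
    rcases le_total (a D) (b D) with h1 | h1 <;> simp [c, h1]
  have hzero : a - c = 0 ↔ b - c = 0 := by
    constructor
    · intro h0
      by_contra h1
      exact h.sum_ne_zero hbc h1 (by rw [← hs, h0]; simp)
    · intro h0
      by_contra h1
      exact h.sum_ne_zero hac h1 (by rw [hs, h0]; simp)
  by_cases h0 : a - c = 0
  · exact (sub_eq_zero.1 h0).trans (sub_eq_zero.1 (hzero.1 h0)).symm
  · exfalso
    obtain ⟨D, hD, hDtop⟩ := hac.exists_top h0
    obtain ⟨E, hE, hEtop⟩ := hbc.exists_top (fun h1 => h0 (hzero.2 h1))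
    have h1 := h.faceLE_sum hac hD hDtop
    have h2 := h.faceLE_sum hbc hE hEtop
    rw [hs] at h1
    obtain rfl := h.eq_of_faceLE (h1.2.trans h2.1) (h2.2.trans h1.1)
    exact (hdisj D).elim hD.ne' hE.ne'

/-- Induction on the number of forms not vanishing at `w`. If `D` is the cell of `w`, the largest
multiple of `p D` that can be removed without leaving `D` makes a further form vanish; the remainder
uses only cells below `D`. -/
theorem exists_chainWeight (w : V) : ∃ a : F → ℝ, IsChainWeight a ∧ ∑ D, a D • p D = w := by
  classical
  induction hn : (Φ.filter fun f => f w ≠ 0).card using Nat.strong_induction_on generalizing w with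
  | _ n ih =>
  subst hn
  rcases eq_or_ne w 0 with rfl | hw
  · exact ⟨0, IsChainWeight.zero, by simp⟩
  obtain ⟨D, hwD, hDw⟩ := h.exists_rep w hw
  have hne : (Φ.filter fun f => 0 < f (p D)).Nonempty := by
    by_contra hemp
    rw [Finset.not_nonempty_iff_eq_empty, Finset.filter_eq_empty_iff] at hemp
    refine h.ne_zero D (h.separating _ fun f hf => le_antisymm (not_lt.1 (hemp hf)) ?_)
    simpa using not_lt.1 (hemp (h.neg_mem f hf))
  -- The form reaching zero first as `w` moves in the direction `-p D`.
  obtain ⟨f₀, hf₀, hmin⟩ := Finset.exists_min_image _ (fun f => f w / f (p D)) hne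
  rw [Finset.mem_filter] at hf₀
  have hpos : ∀ f ∈ Φ, 0 < f (p D) → 0 < f w := fun f hf hfD => by
    by_contra hfw
    exact hfD.not_ge (h.faceLE_nonpos hDw hf (not_lt.1 hfw))
  set t := f₀ w / f₀ (p D)
  have ht : 0 ≤ t := div_nonneg (hpos f₀ hf₀.1 hf₀.2).le hf₀.2.le
  have hzero : ∀ f ∈ Φ, f w = 0 → f (p D) = 0 := fun f hf hfw =>
    le_antisymm (h.faceLE_nonpos hDw hf hfw.le) (hDw f hf hfw.ge)
  have hw' : FaceLE Φ (w - t • p D) (p D) := by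
    intro f hf hfD
    rw [map_sub, map_smul, smul_eq_mul, sub_nonneg]
    rcases hfD.eq_or_lt with h0 | h0
    · rw [← h0, mul_zero]
      exact hwD f hf hfD
    · exact (le_div_iff₀ h0).1 (hmin f (Finset.mem_filter.2 ⟨hf, h0⟩))
  have hcard : (Φ.filter fun f => f (w - t • p D) ≠ 0).card < (Φ.filter fun f => f w ≠ 0).card := by
    refine Finset.card_lt_card ((Finset.ssubset_iff_of_subset fun f hf => ?_).2 ⟨f₀, ?_, ?_⟩)
    · rw [Finset.mem_filter] at hf ⊢
      refine ⟨hf.1, fun hfw => hf.2 ?_⟩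
      simp [hfw, hzero f hf.1 hfw]
    · exact Finset.mem_filter.2 ⟨hf₀.1, (hpos f₀ hf₀.1 hf₀.2).ne'⟩
    · simp [t, hf₀.2.ne']
  obtain ⟨a, ha, haw⟩ := ih _ hcard _ rfl
  have haD : ∀ E, a E ≠ 0 → E ≤ D := fun E hE => by
    have := h.faceLE_of_ne_zero ha hE
    rw [haw] at this
    exact (h.le_iff _ _).2 (this.trans hw')
  refine ⟨a + Pi.single D t, ⟨fun E => add_nonneg (ha.1 E) ?_, fun E E' hE hE' => ?_⟩, ?_⟩
  · rw [Pi.single_apply]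
    split_ifs <;> simp [ht]
  · by_cases h1 : E = D
    · subst h1
      by_cases h2 : E' = E
      · exact Or.inl h2.ge
      · exact Or.inr (haD E' (by simpa [h2] using hE'))
    · by_cases h2 : E' = D
      · subst h2
        exact Or.inl (haD E (by simpa [h1] using hE))
      · exact ha.2 E E' (by simpa [h1] using hE) (by simpa [h2] using hE')
  · simp only [Pi.add_apply, add_smul, Finset.sum_add_distrib, haw]
    rw [Finset.sum_eq_single D (fun E _ hE => by simp [hE]) (by simp)]
    simp

/-- The coordinates of a vector with respect to the barycentric subdivision of the fan. -/
noncomputable def coords (w : V) : F → ℝ := (h.exists_chainWeight w).choose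

theorem isChainWeight_coords (w : V) : IsChainWeight (h.coords w) :=
  (h.exists_chainWeight w).choose_spec.1

theorem sum_coords (w : V) : ∑ D, h.coords w D • p D = w :=
  (h.exists_chainWeight w).choose_spec.2

theorem coords_sum {a : F → ℝ} (ha : IsChainWeight a) : h.coords (∑ D, a D • p D) = a :=
  h.chainWeight_unique (h.isChainWeight_coords _) ha (h.sum_coords _)

theorem faceLE_of_coords_ne_zero {w : V} {D : F} (hD : h.coords w D ≠ 0) : FaceLE Φ (p D) w := by
  simpa only [h.sum_coords] using h.faceLE_of_ne_zero (h.isChainWeight_coords w) hD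

/-- No cancellation occurs: a form that is nonnegative at `w` is nonnegative at every `p E`
occurring in `w`. The bound serves to prove properness in `continuous_coords`. -/
theorem coords_le (w : V) (D : F) :
    h.coords w D ≤ (∑ f ∈ Φ, |f w|) / ∑ f ∈ Φ, |f (p D)| := by
  have ha := h.isChainWeight_coords w
  have hpos : 0 < ∑ f ∈ Φ, |f (p D)| := by
    by_contra hle
    have h0 := le_antisymm (not_lt.1 hle) (Finset.sum_nonneg fun f _ => abs_nonneg _)
    rw [Finset.sum_eq_zero_iff_of_nonneg fun f _ => abs_nonneg _] at h0
    exact h.ne_zero D (h.separating _ fun f hf => abs_eq_zero.1 (h0 f hf))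
  rw [le_div_iff₀ hpos, Finset.mul_sum]
  refine Finset.sum_le_sum fun f hf => ?_
  have key : ∀ f ∈ Φ, 0 ≤ f w → h.coords w D * |f (p D)| ≤ |f w| := by
    intro f hf hfw
    have hE : ∀ E, 0 ≤ h.coords w E * f (p E) := fun E => by
      by_cases hE : h.coords w E = 0
      · simp [hE]
      · exact mul_nonneg (ha.1 E) (h.faceLE_of_coords_ne_zero hE f hf hfw)
    have h1 : f w = ∑ E, h.coords w E * f (p E) := by
      conv_lhs => rw [← h.sum_coords w, map_sum]
      simp
    rw [abs_of_nonneg hfw, ← abs_of_nonneg (ha.1 D), ← abs_mul, abs_of_nonneg (hE D), h1]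
    exact Finset.single_le_sum (f := fun E => h.coords w E * f (p E)) (fun E _ => hE E)
      (Finset.mem_univ D)
  rcases le_total 0 (f w) with hfw | hfw
  · exact key f hf hfw
  · simpa using key (-f) (h.neg_mem f hf) (by simpa using hfw)

/-- The barycenter map on the closed set of chain weights is a continuous bijection onto `V`. By
`coords_le` preimages of compact sets are bounded, so the map is proper, hence closed, and its
inverse is continuous. -/
theorem continuous_coords [FiniteDimensional ℝ V] : Continuous h.coords := by
  let K := {a : F → ℝ | IsChainWeight a}
  let T : K → V := fun a => ∑ D, a.1 D • p D
  have hT : Continuous T := continuous_finsetSum _ fun D _ =>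
    ((continuous_apply D).comp continuous_subtype_val).smul continuous_const
  let e : V ≃ K :=
    { toFun := fun w => ⟨h.coords w, h.isChainWeight_coords w⟩
      invFun := T
      left_inv := h.sum_coords
      right_inv := fun a => Subtype.ext (h.coords_sum a.2) }
  have hproper : IsProperMap T := by
    have := FiniteDimensional.proper_real V
    refine isProperMap_iff_isCompact_preimage.2 ⟨hT, fun Q hQ => ?_⟩
    have hN : Continuous fun w : V => ∑ f ∈ Φ, |f w| := continuous_finsetSum _ fun f _ =>
      (f.continuous_of_finiteDimensional).abs
    obtain ⟨B, hB⟩ := (hQ.image hN).bddAbove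
    have hbox : IsCompact (Subtype.val ⁻¹' Set.Icc (0 : F → ℝ)
        (fun D => B / ∑ f ∈ Φ, |f (p D)|) : Set K) :=
      (IsChainWeight.isClosed_setOf.isClosedEmbedding_subtypeVal).isCompact_preimage isCompact_Icc
    refine hbox.of_isClosed_subset (hQ.isClosed.preimage hT) fun a ha => ⟨a.2.1, fun D => ?_⟩
    have h1 := h.coords_le (T a) D
    rw [h.coords_sum a.2] at h1
    exact h1.trans (div_le_div_of_nonneg_right (hB (Set.mem_image_of_mem _ ha))
      (Finset.sum_nonneg fun f _ => abs_nonneg _))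
  exact continuous_subtype_val.comp
    (e.symm.toHomeomorphOfContinuousClosed hT hproper.isClosedMap).symm.continuous

end IsCellSystem

end Cells

/-! ### Retraction onto a sphere -/

namespace PosetRealization

variable {Q : Type*} [PartialOrder Q]

/-- The point with barycentric coordinates proportional to given weights. -/
noncomputable def normalize (z : Q →₀ ℝ) (h0 : ∀ c, 0 ≤ z c) (hz : z ≠ 0)
    (hc : IsChain (· ≤ ·) (z.support : Set Q)) : PosetRealization Q :=
  ofWeight ((z.sum fun _ a => a)⁻¹ • z)
    (fun c => mul_nonneg (inv_nonneg.2 (Finsupp.sum_nonneg fun c _ => h0 c)) (h0 c))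
    (by
      rw [Finsupp.sum_id_smul, inv_mul_cancel₀]
      obtain ⟨c, hc⟩ := Finsupp.support_nonempty_iff.2 hz
      exact (Finset.sum_pos' (fun c _ => h0 c)
        ⟨c, hc, (h0 c).lt_of_ne' (Finsupp.mem_support_iff.1 hc)⟩).ne')
    (hc.mono (Finset.coe_subset.2 Finsupp.support_smul))

theorem coe_normalize {z : Q →₀ ℝ} {h0 : ∀ c, 0 ≤ z c} {hz : z ≠ 0}
    {hc : IsChain (· ≤ ·) (z.support : Set Q)} :
    (normalize z h0 hz hc).1 = (z.sum fun _ a => a)⁻¹ • z := rfl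

theorem normalize_eq {z : Q →₀ ℝ} {h0 : ∀ c, 0 ≤ z c} {hz : z ≠ 0}
    {hc : IsChain (· ≤ ·) (z.support : Set Q)} {x : PosetRealization Q} {c : ℝ} (hc0 : c ≠ 0)
    (hx : z = c • x.1) : normalize z h0 hz hc = x := Subtype.ext <| by
  rw [coe_normalize, hx, Finsupp.sum_id_smul, x.2.2.1, mul_one, smul_smul, inv_mul_cancel₀ hc0,
    one_smul]

theorem support_normalize_subset {z : Q →₀ ℝ} {h0 : ∀ c, 0 ≤ z c} {hz : z ≠ 0}
    {hc : IsChain (· ≤ ·) (z.support : Set Q)} : (normalize z h0 hz hc).1.support ⊆ z.support :=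
  Finsupp.support_smul

theorem continuous_normalize {Y : Type*} [TopologicalSpace Y] {z : Y → Q →₀ ℝ}
    {h0 : ∀ y c, 0 ≤ z y c} {hz : ∀ y, z y ≠ 0}
    {hc : ∀ y, IsChain (· ≤ ·) ((z y).support : Set Q)} (W : Finset Q)
    (hW : ∀ y, (z y).support ⊆ W) (hcont : ∀ c, Continuous fun y => z y c) :
    Continuous fun y => normalize (z y) (h0 y) (hz y) (hc y) := by
  refine GeomRealization.continuous_of_coord W
    (fun y => support_normalize_subset.trans (hW y)) fun i => ?_
  have hs : ∀ y, ((z y).sum fun _ a => a) = ∑ c ∈ W, z y c :=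
    fun y => Finsupp.sum_of_support_subset _ (hW y) _ (by simp)
  change Continuous fun y => ((z y).sum fun _ a => a)⁻¹ * z y i
  refine Continuous.mul (Continuous.inv₀ ?_ fun y => ?_) (hcont i)
  · simp only [hs]
    exact continuous_finsetSum _ fun c _ => hcont c
  · obtain ⟨c, hc⟩ := Finsupp.support_nonempty_iff.2 (hz y)
    exact (Finset.sum_pos' (fun c _ => h0 y c)
      ⟨c, hc, (h0 y c).lt_of_ne' (Finsupp.mem_support_iff.1 hc)⟩).ne'

theorem isChain_lowPart (t : ℝ) (x : PosetRealization Q) :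
    IsChain (· ≤ ·) ((lowPart t x.1).support : Set Q) :=
  (isChain_support x).mono (by exact_mod_cast support_lowPart_subset t x.1)

end PosetRealization

/-! ### Deformation of unions of cells onto the subdivided sphere -/

section Subdivision

variable {V : Type*} [NormedAddCommGroup V] [NormedSpace ℝ V] {Q : Type*} [PartialOrder Q]

/-- A finite set `W` of salient cones that are unions of cells of the arrangement `Φ`; the nonzero
cells themselves form the subset `F`. -/
structure IsSubdividedBy (Φ : Finset (Module.Dual ℝ V)) (K : Q → PointedCone ℝ V) (p : Q → V)
    (F W : Finset Q) : Prop where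
  subset : F ⊆ W
  mono : Monotone K
  salient : ∀ C, ∀ v ∈ K C, -v ∈ K C → v = 0
  mem : ∀ C, p C ∈ K C
  ne_zero : ∀ C, p C ≠ 0
  cells : IsCellSystem Φ fun D : F => p D
  le_of_faceLE : ∀ C ∈ W, ∀ v ∈ K C, ∀ D ∈ F, FaceLE Φ (p D) v → D ≤ C

namespace IsSubdividedBy

open PosetRealization unitInterval

variable {Φ : Finset (Module.Dual ℝ V)} {K : Q → PointedCone ℝ V} {p : Q → V} {F W : Finset Q}
  (h : IsSubdividedBy Φ K p F W)
include h

theorem linearCombination_mem {z : Q →₀ ℝ} (hz : ∀ c, 0 ≤ z c) {C : Q}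
    (hC : ∀ E ∈ z.support, E ≤ C) : Finsupp.linearCombination ℝ p z ∈ K C := by
  rw [Finsupp.linearCombination_apply]
  exact Submodule.sum_mem _ fun E hE =>
    (K C).smul_mem (hz E) (h.mono (hC E hE) (h.mem E))

/-- All terms lie in the top cone `C` of the chain; a zero sum would put the nonzero term of `C` and
its negative in `C`. -/
theorem linearCombination_ne_zero {z : Q →₀ ℝ} (hz : ∀ c, 0 ≤ z c) (h0 : z ≠ 0)
    (hc : IsChain (· ≤ ·) (z.support : Set Q)) : Finsupp.linearCombination ℝ p z ≠ 0 := by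
  classical
  intro hs
  obtain ⟨C, hC, hmax⟩ := z.support.exists_maximal (Finsupp.support_nonempty_iff.2 h0)
  have htop : ∀ E ∈ z.support, E ≤ C := fun E hE =>
    (hc.total hE hC).elim id fun h => hmax hE h
  have hmem : ∀ E ∈ z.support, z E • p E ∈ K C := fun E hE =>
    (K C).smul_mem (hz E) (h.mono (htop E hE) (h.mem E))
  rw [Finsupp.linearCombination_apply, Finsupp.sum, ← Finset.add_sum_erase _ _ hC] at hs
  have h1 := h.salient C _ (hmem C hC) (by
    rw [neg_eq_of_add_eq_zero_right hs]
    exact Submodule.sum_mem _ fun E hE => hmem E (Finset.mem_of_mem_erase hE))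
  exact (smul_ne_zero (Finsupp.mem_support_iff.1 hC) (h.ne_zero C)) h1

/-- The barycentric coordinates of a vector, as weights on the whole poset. -/
noncomputable def weight (w : V) : Q →₀ ℝ :=
  (Finsupp.equivFunOnFinite.symm (h.cells.coords w)).mapDomain Subtype.val

theorem weight_apply_mem (w : V) {D : Q} (hD : D ∈ F) :
    h.weight w D = h.cells.coords w ⟨D, hD⟩ :=
  Finsupp.mapDomain_apply Subtype.val_injective _ (⟨D, hD⟩ : F)

theorem weight_apply_notMem (w : V) {D : Q} (hD : D ∉ F) : h.weight w D = 0 :=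
  Finsupp.mapDomain_of_notMem_range _ _ (by simpa using hD)

theorem weight_nonneg (w : V) (D : Q) : 0 ≤ h.weight w D := by
  by_cases hD : D ∈ F
  · rw [h.weight_apply_mem w hD]
    exact (h.cells.isChainWeight_coords w).1 _
  · rw [h.weight_apply_notMem w hD]

theorem support_weight_subset (w : V) : (h.weight w).support ⊆ F := fun D hD => by
  by_contra hDF
  exact Finsupp.mem_support_iff.1 hD (h.weight_apply_notMem w hDF)

theorem isChain_weight (w : V) : IsChain (· ≤ ·) ((h.weight w).support : Set Q) := by
  intro D hD E hE _
  have hDF := h.support_weight_subset w hD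
  have hEF := h.support_weight_subset w hE
  have hD' := Finsupp.mem_support_iff.1 hD
  have hE' := Finsupp.mem_support_iff.1 hE
  rw [h.weight_apply_mem w hDF] at hD'
  rw [h.weight_apply_mem w hEF] at hE'
  exact (h.cells.isChainWeight_coords w).2 _ _ hD' hE'

theorem linearCombination_weight (w : V) : Finsupp.linearCombination ℝ p (h.weight w) = w := by
  rw [weight, Finsupp.linearCombination_mapDomain, Finsupp.linearCombination_apply,
    Finsupp.sum_fintype _ _ (by simp)]
  exact h.cells.sum_coords w

theorem weight_linearCombination {z : Q →₀ ℝ} (hz : ∀ c, 0 ≤ z c)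
    (hc : IsChain (· ≤ ·) (z.support : Set Q)) (hF : z.support ⊆ F) :
    h.weight (Finsupp.linearCombination ℝ p z) = z := by
  have ha : IsChainWeight fun D : F => z D := ⟨fun D => hz D, fun D E hD hE =>
    hc.total (Finsupp.mem_support_iff.2 hD) (Finsupp.mem_support_iff.2 hE)⟩
  have hs : Finsupp.linearCombination ℝ p z = ∑ D : F, z D • p D := by
    rw [Finsupp.linearCombination_apply, Finsupp.sum_of_support_subset _ hF _ (by simp)]
    exact (Finset.sum_coe_sort F fun D => z D • p D).symm
  ext D
  by_cases hD : D ∈ F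
  · rw [h.weight_apply_mem _ hD, hs, h.cells.coords_sum ha]
  · rw [h.weight_apply_notMem _ hD]
    by_contra h0
    exact hD (hF (Finsupp.mem_support_iff.2 (Ne.symm h0)))

theorem weight_smul {c : ℝ} (hc : 0 ≤ c) (w : V) : h.weight (c • w) = c • h.weight w := by
  rw [← h.weight_linearCombination (z := c • h.weight w)
    (fun D => mul_nonneg hc (h.weight_nonneg w D))
    ((h.isChain_weight w).mono (Finset.coe_subset.2 Finsupp.support_smul))
    (Finsupp.support_smul.trans (h.support_weight_subset w)), map_smul, h.linearCombination_weight]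

theorem weight_ne_zero {w : V} (hw : w ≠ 0) : h.weight w ≠ 0 := fun h0 => hw <| by
  rw [← h.linearCombination_weight w, h0, map_zero]

theorem weight_zero : h.weight 0 = 0 := by
  simpa using h.weight_smul le_rfl 0

theorem continuous_weight_apply [FiniteDimensional ℝ V] (D : Q) :
    Continuous fun w => h.weight w D := by
  by_cases hD : D ∈ F
  · simp only [h.weight_apply_mem _ hD]
    exact (continuous_apply _).comp h.cells.continuous_coords
  · simp only [h.weight_apply_notMem _ hD]
    exact continuous_const

/-- The top part of `x` stays, and the bottom part of mass `t` is redistributed among the cells. -/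
noncomputable def deform (t : ℝ) (x : PosetRealization Q) : Q →₀ ℝ :=
  (x.1 - lowPart t x.1) + h.weight (Finsupp.linearCombination ℝ p (lowPart t x.1))

theorem deform_nonneg (t : ℝ) (x : PosetRealization Q) (C : Q) : 0 ≤ h.deform t x C :=
  add_nonneg (sub_nonneg.2 (lowPart_le t x.1 C)) (h.weight_nonneg _ C)

/-- Both summands are nonnegative, so both would vanish: all of `x` would be in the bottom part,
whose barycenter is then nonzero. The total mass need not stay `1`, hence the later normalization.
-/
theorem deform_ne_zero (t : ℝ) (x : PosetRealization Q) : h.deform t x ≠ 0 := by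
  intro h0
  have h1 : ∀ C, (x.1 - lowPart t x.1) C = 0 ∧
      h.weight (Finsupp.linearCombination ℝ p (lowPart t x.1)) C = 0 := fun C =>
    (add_eq_zero_iff_of_nonneg (sub_nonneg.2 (lowPart_le t x.1 C)) (h.weight_nonneg _ C)).1
      (DFunLike.congr_fun h0 C)
  have h2 : x.1 = lowPart t x.1 := sub_eq_zero.1 (Finsupp.ext fun C => (h1 C).1)
  have h3 : lowPart t x.1 ≠ 0 := fun h4 => by
    have := x.2.2.1
    rw [h2.trans h4] at this
    simp at this
  exact h.weight_ne_zero (h.linearCombination_ne_zero (lowPart_nonneg t x.2.1) h3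
    (isChain_lowPart t x)) (Finsupp.ext fun C => (h1 C).2)

theorem mem_support_deform {t : ℝ} {x : PosetRealization Q} {C : Q}
    (hC : C ∈ (h.deform t x).support) : C ∈ (x.1 - lowPart t x.1).support ∨
      C ∈ (h.weight (Finsupp.linearCombination ℝ p (lowPart t x.1))).support := by
  classical
  exact Finset.mem_union.1 (Finsupp.support_add hC)

theorem support_deform_subset (t : ℝ) {x : PosetRealization Q} (hx : x.1.support ⊆ W) :
    (h.deform t x).support ⊆ W := fun _ hC => (h.mem_support_deform hC).elim
  (fun h1 => hx (support_sub_lowPart_subset t x.1 h1))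
  (fun h1 => h.subset (h.support_weight_subset _ h1))

/-- A cone `C` of the remaining part contains all cones of the bottom part, hence their barycenter.
As a union of cells it contains every cell in the expansion of that barycenter. -/
theorem isChain_deform (t : ℝ) {x : PosetRealization Q} (hx : x.1.support ⊆ W) :
    IsChain (· ≤ ·) ((h.deform t x).support : Set Q) := by
  have key : ∀ C ∈ (x.1 - lowPart t x.1).support,
      ∀ D ∈ (h.weight (Finsupp.linearCombination ℝ p (lowPart t x.1))).support, D ≤ C := by
    intro C hC D hD
    have hDF := h.support_weight_subset _ hD
    refine h.le_of_faceLE C (hx (support_sub_lowPart_subset t x.1 hC)) _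
      (h.linearCombination_mem (lowPart_nonneg t x.2.1) fun E hE =>
        le_of_mem_support_lowPart x.2.1 (isChain_support x) hE hC) D hDF ?_
    have hD' := Finsupp.mem_support_iff.1 hD
    rw [h.weight_apply_mem _ hDF] at hD'
    exact h.cells.faceLE_of_coords_ne_zero hD'
  intro C hC D hD _
  rcases h.mem_support_deform hC with hC | hC <;> rcases h.mem_support_deform hD with hD | hD
  · exact (isChain_support x).total (support_sub_lowPart_subset t x.1 hC)
      (support_sub_lowPart_subset t x.1 hD)
  · exact Or.inr (key C hC D hD)
  · exact Or.inl (key D hD C hC)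
  · exact (h.isChain_weight _).total hC hD

theorem deform_zero (x : PosetRealization Q) : h.deform 0 x = x.1 := by
  rw [deform, lowPart_zero x.2.1, map_zero, h.weight_zero, sub_zero, add_zero]

theorem deform_one (x : PosetRealization Q) :
    h.deform 1 x = h.weight (Finsupp.linearCombination ℝ p x.1) := by
  rw [deform, lowPart_one x.2.1 x.2.2.1, sub_self, zero_add]

/-- Uniqueness of coordinates makes the deformation stationary on `|F|`, so the retraction is
strong. -/
theorem deform_of_support_subset (t : ℝ) {x : PosetRealization Q} (hx : x.1.support ⊆ F) :
    h.deform t x = x.1 := by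
  rw [deform, h.weight_linearCombination (lowPart_nonneg t x.2.1) (isChain_lowPart t x)
    ((support_lowPart_subset t x.1).trans hx), sub_add_cancel]

theorem continuous_deform_apply [FiniteDimensional ℝ V] (C : Q) :
    Continuous fun q : I × GeomRealization.supported (orderComplex Q) (W : Set Q) =>
      h.deform q.1 q.2.1 C := by
  have hs : ∀ q : I × GeomRealization.supported (orderComplex Q) (W : Set Q),
      q.2.1.1.support ⊆ W := fun q => by exact_mod_cast q.2.2
  have hx : ∀ C, Continuous fun q : I × GeomRealization.supported (orderComplex Q) (W : Set Q) =>
      q.2.1.1 C := fun C => (GeomRealization.continuous_coord C).comp (by fun_prop)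
  have hlow : ∀ C, Continuous fun q : I × GeomRealization.supported (orderComplex Q) (W : Set Q) =>
      lowPart q.1 q.2.1.1 C := continuous_lowPart_apply (by fun_prop) hx W hs
  refine ((hx C).sub (hlow C)).add ((h.continuous_weight_apply C).comp ?_)
  simp only [Finsupp.linearCombination_apply, Finsupp.sum_of_support_subset _
    ((support_lowPart_subset _ _).trans (hs _)) (fun C a => a • p C) (by simp)]
  exact continuous_finsetSum _ fun C _ => (hlow C).smul continuous_const

/-- The normalization of `deform`. -/
noncomputable def deformPoint (t : ℝ) (x : PosetRealization Q) (hx : x.1.support ⊆ W) :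
    PosetRealization Q :=
  normalize (h.deform t x) (h.deform_nonneg t x) (h.deform_ne_zero t x) (h.isChain_deform t hx)

theorem support_deformPoint_subset (t : ℝ) (x : PosetRealization Q) (hx : x.1.support ⊆ W) :
    (h.deformPoint t x hx).1.support ⊆ (h.deform t x).support :=
  support_normalize_subset

theorem deformPoint_mem_supported (t : ℝ) (x : PosetRealization Q) (hx : x.1.support ⊆ W) :
    h.deformPoint t x hx ∈ GeomRealization.supported (orderComplex Q) (W : Set Q) :=
  Finset.coe_subset.2 ((h.support_deformPoint_subset t x hx).trans (h.support_deform_subset t hx))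

theorem deformPoint_eq {t : ℝ} {x : PosetRealization Q} (hx : x.1.support ⊆ W)
    (hz : h.deform t x = x.1) : h.deformPoint t x hx = x :=
  normalize_eq one_ne_zero (by rw [one_smul, hz])

theorem continuous_deformPoint [FiniteDimensional ℝ V] :
    Continuous fun q : I × GeomRealization.supported (orderComplex Q) (W : Set Q) =>
      h.deformPoint q.1 q.2.1 (Finset.coe_subset.1 q.2.2) :=
  continuous_normalize W (fun q => h.support_deform_subset q.1 (Finset.coe_subset.1 q.2.2))
    h.continuous_deform_apply

/-- The deformation of the realization of `W` onto that of `F`. -/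
noncomputable def deformation [FiniteDimensional ℝ V] :
    C(I × GeomRealization.supported (orderComplex Q) (W : Set Q),
      GeomRealization.supported (orderComplex Q) (W : Set Q)) where
  toFun q := ⟨h.deformPoint q.1 q.2.1 (Finset.coe_subset.1 q.2.2),
    h.deformPoint_mem_supported _ _ _⟩
  continuous_toFun := h.continuous_deformPoint.subtype_mk _

theorem isStrongDeformationRetract [FiniteDimensional ℝ V] :
    IsStrongDeformationRetract {x : GeomRealization.supported (orderComplex Q) (W : Set Q) |
      x.1.1.support ⊆ F} := by
  let r : C(GeomRealization.supported (orderComplex Q) (W : Set Q),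
      GeomRealization.supported (orderComplex Q) (W : Set Q)) :=
    h.deformation.comp ⟨fun x => (1, x), by fun_prop⟩
  refine ⟨r, fun x => ?_, ⟨{
    toFun := h.deformation
    continuous_toFun := h.deformation.continuous
    map_zero_left := fun x => Subtype.ext (h.deformPoint_eq (Finset.coe_subset.1 x.2) (h.deform_zero x.1))
    map_one_left := fun x => rfl
    prop' := fun t x hx => Subtype.ext (h.deformPoint_eq (Finset.coe_subset.1 x.2) (h.deform_of_support_subset t hx)) }⟩⟩
  have h1 : (h.deform (1 : ℝ) x.1).support ⊆ F := by
    rw [h.deform_one]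
    exact h.support_weight_subset _
  exact (h.support_deformPoint_subset 1 x.1 (Finset.coe_subset.1 x.2)).trans h1

/-- The point of the subdivided sphere in the direction of a nonzero vector. -/
noncomputable def cellPoint {w : V} (hw : w ≠ 0) : PosetRealization Q :=
  normalize (h.weight w) (h.weight_nonneg w) (h.weight_ne_zero hw) (h.isChain_weight w)

theorem support_cellPoint_subset {w : V} (hw : w ≠ 0) : (h.cellPoint hw).1.support ⊆ F :=
  support_normalize_subset.trans (h.support_weight_subset w)

theorem cellPoint_eq {x : PosetRealization Q} (hx : x.1.support ⊆ F) {w : V} (hw : w ≠ 0) {c : ℝ}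
    (hc : 0 < c) (hwx : w = c • Finsupp.linearCombination ℝ p x.1) : h.cellPoint hw = x :=
  normalize_eq hc.ne' (by
    rw [hwx, h.weight_smul hc.le, h.weight_linearCombination x.2.1 (isChain_support x) hx])

theorem exists_linearCombination_cellPoint {w : V} (hw : w ≠ 0) :
    ∃ c : ℝ, 0 ≤ c ∧ Finsupp.linearCombination ℝ p (h.cellPoint hw).1 = c • w :=
  ⟨_, inv_nonneg.2 (Finsupp.sum_nonneg fun C _ => h.weight_nonneg w C), by
    rw [cellPoint, coe_normalize, map_smul, h.linearCombination_weight]⟩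

/-- Radial projection of the barycenter, with inverse given by the normalized coordinates of a
direction. Positive homogeneity of `weight` makes the choice of norm irrelevant. -/
theorem nonempty_homeomorph_sphere [FiniteDimensional ℝ V] {E : Type*} [NormedAddCommGroup E]
    [NormedSpace ℝ E] (e : V ≃L[ℝ] E) :
    Nonempty ({x : GeomRealization.supported (orderComplex Q) (W : Set Q) |
      x.1.1.support ⊆ F} ≃ₜ Metric.sphere (0 : E) 1) := by
  let A := {x : GeomRealization.supported (orderComplex Q) (W : Set Q) | x.1.1.support ⊆ F}
  let T : A → V := fun x => Finsupp.linearCombination ℝ p x.1.1.1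
  have hT : Continuous T := by
    have hs : ∀ x : A, x.1.1.1.support ⊆ F := fun x => x.2
    simp only [T, Finsupp.linearCombination_apply, Finsupp.sum_of_support_subset _ (hs _)
      (fun C a => a • p C) (by simp)]
    exact continuous_finsetSum _ fun C _ => ((GeomRealization.continuous_coord C).comp
      (continuous_subtype_val.comp continuous_subtype_val)).smul continuous_const
  have hT0 : ∀ x, e (T x) ≠ 0 := fun x => by
    rw [Ne, e.map_eq_zero_iff]
    exact h.linearCombination_ne_zero x.1.1.2.1
      (Finsupp.support_nonempty_iff.1 x.1.1.2.2.2.1) (isChain_support x.1.1)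
  have hu0 : ∀ u : Metric.sphere (0 : E) 1, e.symm u.1 ≠ 0 := fun u => by
    rw [Ne, e.symm.map_eq_zero_iff]
    exact ne_zero_of_mem_unit_sphere u
  have hgc : Continuous fun u : Metric.sphere (0 : E) 1 => h.cellPoint (hu0 u) :=
    continuous_normalize F (fun u => h.support_weight_subset _)
      fun C => (h.continuous_weight_apply C).comp (e.symm.continuous.comp continuous_subtype_val)
  let g : Metric.sphere (0 : E) 1 → A := fun u => ⟨⟨h.cellPoint (hu0 u),
    Finset.coe_subset.2 ((h.support_cellPoint_subset (hu0 u)).trans h.subset)⟩,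
    h.support_cellPoint_subset (hu0 u)⟩
  exact ⟨{
    toFun := fun x => ⟨‖e (T x)‖⁻¹ • e (T x), by
      rw [mem_sphere_zero_iff_norm, norm_smul, norm_inv, norm_norm,
        inv_mul_cancel₀ (norm_ne_zero_iff.2 (hT0 x))]⟩
    invFun := g
    left_inv := fun x => Subtype.ext (Subtype.ext (h.cellPoint_eq x.2 (hu0 _)
      (inv_pos.2 (norm_pos_iff.2 (hT0 x))) (by
        simp only [map_smul, ContinuousLinearEquiv.symm_apply_apply]
        rfl)))
    right_inv := fun u => by
      refine Subtype.ext ?_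
      obtain ⟨c, hc, hcu⟩ := h.exists_linearCombination_cellPoint (hu0 u)
      have h1 : e (T (g u)) = c • u.1 := by
        rw [← e.apply_symm_apply u.1, ← map_smul, ← hcu]
      have h2 := hT0 (g u)
      simp only
      rw [h1] at h2 ⊢
      rw [norm_smul, norm_eq_of_mem_sphere u, mul_one, Real.norm_of_nonneg hc, smul_smul,
        inv_mul_cancel₀ (left_ne_zero_of_smul h2), one_smul]
    continuous_toFun := by
      have he : Continuous fun x => e (T x) := e.continuous.comp hT
      exact ((he.norm.inv₀ fun x => norm_ne_zero_iff.2 (hT0 x)).smul he).subtype_mk _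
    continuous_invFun := Continuous.subtype_mk (Continuous.subtype_mk hgc _) _ }⟩

end IsSubdividedBy

end Subdivision

/-! ### Cells of rational hyperplane arrangements -/

open scoped Matrix

namespace Cones

variable {d : ℕ}

open Classical in
/-- The forms in `L` and the coordinate forms, together with their negatives. -/
noncomputable def arrangement (L : Finset (Fin d → ℤ)) : Finset (Fin d → ℤ) :=
  -- The coordinate forms make the arrangement separate points, whence its cells are salient.
  let M := L ∪ Finset.univ.image fun i => Pi.single i 1
  M ∪ M.image fun l => -l

theorem mem_arrangement {L : Finset (Fin d → ℤ)} {l : Fin d → ℤ} : l ∈ arrangement L ↔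
    (l ∈ L ∨ ∃ i, Pi.single i 1 = l) ∨ (-l ∈ L ∨ ∃ i, Pi.single i 1 = -l) := by
  simp only [arrangement, Finset.mem_union, Finset.mem_image, Finset.mem_univ, true_and]
  refine or_congr_right ⟨?_, fun h => ⟨-l, h, neg_neg l⟩⟩
  rintro ⟨m, hm, rfl⟩
  rwa [neg_neg]

/-- The linear form with given integer coefficients. -/
noncomputable def latticeForm (l : Fin d → ℤ) : Module.Dual ℝ (Fin d → ℝ) where
  toFun y := latticeVec l ⬝ᵥ y
  map_add' := dotProduct_add _
  map_smul' c y := dotProduct_smul c _ y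

open Classical in
/-- The linear forms of the arrangement. -/
noncomputable def forms (L : Finset (Fin d → ℤ)) : Finset (Module.Dual ℝ (Fin d → ℝ)) :=
  (arrangement L).image latticeForm

theorem faceLE_forms_iff {L : Finset (Fin d → ℤ)} {y v : Fin d → ℝ} : FaceLE (forms L) y v ↔
    ∀ l ∈ arrangement L, 0 ≤ latticeVec l ⬝ᵥ v → 0 ≤ latticeVec l ⬝ᵥ y := by
  classical
  simp only [FaceLE, forms, Finset.forall_mem_image]
  rfl

theorem neg_mem_forms {L : Finset (Fin d → ℤ)} {f : Module.Dual ℝ (Fin d → ℝ)}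
    (hf : f ∈ forms L) : -f ∈ forms L := by
  classical
  obtain ⟨l, hl, rfl⟩ := Finset.mem_image.1 hf
  refine Finset.mem_image.2 ⟨-l, ?_, LinearMap.ext fun y => ?_⟩
  · rw [mem_arrangement] at hl ⊢
    rw [neg_neg]
    exact hl.symm
  · have : latticeVec (-l) = -latticeVec l := by ext; simp [latticeVec]
    simp [latticeForm, this]

theorem eq_zero_of_forms {L : Finset (Fin d → ℤ)} {v : Fin d → ℝ} (h : ∀ f ∈ forms L, f v = 0) :
    v = 0 := by
  classical
  ext i
  have := h _ (Finset.mem_image_of_mem _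
    (mem_arrangement.2 (Or.inl (Or.inr ⟨i, rfl⟩)) : Pi.single i 1 ∈ arrangement L))
  simpa [latticeForm, latticeVec_single] using this

theorem faceLE_forms_mono {L M : Finset (Fin d → ℤ)} (hLM : L ⊆ M) {y v : Fin d → ℝ}
    (h : FaceLE (forms M) y v) : FaceLE (forms L) y v := by
  rw [faceLE_forms_iff] at h ⊢
  refine fun l hl => h l ?_
  rw [mem_arrangement] at hl ⊢
  exact hl.imp (Or.imp_left fun h => hLM h) (Or.imp_left fun h => hLM h)

/-- The forms nonnegative at `v` cut out a finitely generated rational cone by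
`exists_hull_of_inequalities`. It is salient because each form or its negative is among them, so
every form vanishes at `y` if `±y` both belong. -/
theorem exists_cell (L : Finset (Fin d → ℤ)) (v : Fin d → ℝ) :
    ∃ C : Cones d, ∀ y, y ∈ C.toCone ↔ FaceLE (forms L) y v := by
  classical
  obtain ⟨s, hs⟩ :=
    exists_hull_of_inequalities ((arrangement L).filter fun l => 0 ≤ latticeVec l ⬝ᵥ v)
  have hmem : ∀ y, y ∈ PointedCone.hull ℝ (latticeVec '' (s : Set (Fin d → ℤ))) ↔
      FaceLE (forms L) y v := fun y => by
    rw [hs, faceLE_forms_iff]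
    simp only [Finset.mem_filter, and_imp]
  refine ⟨⟨_, ⟨s, rfl⟩, fun y hy hy' => eq_zero_of_forms (L := L) fun f hf => ?_⟩, hmem⟩
  rw [hmem] at hy hy'
  have key : ∀ f ∈ forms L, 0 ≤ f v → f y = 0 := fun f hf hfv =>
    le_antisymm (by simpa using hy' f hf hfv) (hy f hf hfv)
  rcases le_total 0 (f v) with hfv | hfv
  · exact key f hf hfv
  · simpa using key (-f) (neg_mem_forms hf) (by simpa using hfv)

/-- The smallest cell containing `v`. -/
noncomputable def cell (L : Finset (Fin d → ℤ)) (v : Fin d → ℝ) : Cones d :=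
  (exists_cell L v).choose

theorem mem_cell {L : Finset (Fin d → ℤ)} {y v : Fin d → ℝ} :
    y ∈ (cell L v).toCone ↔ FaceLE (forms L) y v := (exists_cell L v).choose_spec y

/-- `C` is a union of cells of the arrangement. -/
def IsUnionOfCells (L : Finset (Fin d → ℤ)) (C : Cones d) : Prop :=
  ∀ v ∈ C.toCone, ∀ y, FaceLE (forms L) y v → y ∈ C.toCone

theorem isUnionOfCells_cell (L : Finset (Fin d → ℤ)) (v : Fin d → ℝ) :
    IsUnionOfCells L (cell L v) := fun _ hw _ hy => mem_cell.2 (hy.trans (mem_cell.1 hw))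

theorem IsUnionOfCells.mono {L M : Finset (Fin d → ℤ)} (hLM : L ⊆ M) {C : Cones d}
    (h : IsUnionOfCells L C) : IsUnionOfCells M C := fun v hv y hy => h v hv y (faceLE_forms_mono hLM hy)

theorem exists_isUnionOfCells (C : Cones d) : ∃ L, IsUnionOfCells L C := by
  obtain ⟨s, hs⟩ := C.rational
  obtain ⟨L, hL⟩ := exists_inequalities_of_hull s
  refine ⟨L, fun v hv y hy => ?_⟩
  rw [hs, hL] at hv ⊢
  exact fun l hl => faceLE_forms_iff.1 hy l (mem_arrangement.2 (Or.inl (Or.inl hl))) (hv l hl)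

/-- A union of cells is determined by the sign patterns of its points, and only finitely many
patterns exist. -/
theorem finite_isUnionOfCells (L : Finset (Fin d → ℤ)) :
    {C : {C : Cones d // C ≠ 0} | IsUnionOfCells L C.1}.Finite := by
  classical
  let sgn : (Fin d → ℝ) → Set (Module.Dual ℝ (Fin d → ℝ)) := fun v => {f | f ∈ forms L ∧ 0 ≤ f v}
  refine Set.Finite.of_finite_image (f := fun C => sgn '' (C.1.toCone : Set (Fin d → ℝ)))
    (((forms L).finite_toSet.finite_subsets.finite_subsets).subset ?_) ?_
  · rintro _ ⟨C, -, rfl⟩ _ ⟨v, -, rfl⟩ f hf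
    exact hf.1
  · have key : ∀ C D : {C : Cones d // C ≠ 0}, IsUnionOfCells L D.1 →
        sgn '' (C.1.toCone : Set (Fin d → ℝ)) ⊆ sgn '' (D.1.toCone : Set (Fin d → ℝ)) →
        C.1.toCone ≤ D.1.toCone := by
      intro C D hD hCD v hv
      obtain ⟨w, hw, hwv⟩ := hCD ⟨v, hv, rfl⟩
      exact hD w hw v fun f hf hfw => (hwv ▸ (⟨hf, hfw⟩ : f ∈ sgn w) : f ∈ sgn v).2
    exact fun C hC D hD h => Subtype.ext (Cones.ext
      (le_antisymm (key C D hD h.subset) (key D C hC h.superset)))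

/-- The nonzero cones that are unions of cells. -/
noncomputable def unionsOfCells (L : Finset (Fin d → ℤ)) : Finset {C : Cones d // C ≠ 0} :=
  (finite_isUnionOfCells L).toFinset

theorem mem_unionsOfCells {L : Finset (Fin d → ℤ)} {C : {C : Cones d // C ≠ 0}} :
    C ∈ unionsOfCells L ↔ IsUnionOfCells L C.1 := Set.Finite.mem_toFinset _

theorem unionsOfCells_mono {L M : Finset (Fin d → ℤ)} (hLM : L ⊆ M) :
    unionsOfCells L ⊆ unionsOfCells M := fun _ hC =>
  mem_unionsOfCells.2 ((mem_unionsOfCells.1 hC).mono hLM)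

open Classical in
/-- The nonzero cells. -/
noncomputable def nonzeroCells (L : Finset (Fin d → ℤ)) : Finset {C : Cones d // C ≠ 0} :=
  (unionsOfCells L).filter fun C => ∃ v, C.1 = cell L v

theorem mem_nonzeroCells {L : Finset (Fin d → ℤ)} {C : {C : Cones d // C ≠ 0}} :
    C ∈ nonzeroCells L ↔ ∃ v, C.1 = cell L v := by
  classical
  rw [nonzeroCells, Finset.mem_filter, and_iff_right_iff_imp, mem_unionsOfCells]
  rintro ⟨v, hv⟩
  rw [hv]
  exact isUnionOfCells_cell L v

/-- Supplies `p`: for a cell a relative interior point is required, for any other cone a nonzero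
point suffices. -/
theorem exists_point (L : Finset (Fin d → ℤ)) (C : {C : Cones d // C ≠ 0}) :
    ∃ v ∈ C.1.toCone, v ≠ 0 ∧ (C ∈ nonzeroCells L → C.1 = cell L v) := by
  by_cases hC : C ∈ nonzeroCells L
  · obtain ⟨v, hv⟩ := mem_nonzeroCells.1 hC
    refine ⟨v, hv ▸ mem_cell.2 (FaceLE.refl _ v), ?_, fun _ => hv⟩
    rintro rfl
    obtain ⟨x, hx, hx0⟩ := ne_zero_iff.1 C.2
    rw [hv, mem_cell] at hx
    refine hx0 (eq_zero_of_forms (L := L) fun f hf => le_antisymm ?_ (hx f hf (by simp)))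
    simpa using hx _ (neg_mem_forms hf) (by simp)
  · obtain ⟨v, hv, hv0⟩ := ne_zero_iff.1 C.2
    exact ⟨v, hv, hv0, fun h => absurd h hC⟩

/-- The assumption on the order enters here: inclusions between cells and unions of cells must be
relations of the poset for the supports to be chains. -/
theorem OrderIsInclusion.exists_isSubdividedBy (h : OrderIsInclusion d)
    (L : Finset (Fin d → ℤ)) : ∃ p : {C : Cones d // C ≠ 0} → Fin d → ℝ,
      IsSubdividedBy (forms L) (fun C => C.1.toCone) p (nonzeroCells L) (unionsOfCells L) := by
  classical
  choose p hp hp0 hcell using exists_point L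
  have hle : ∀ {C D : {C : Cones d // C ≠ 0}}, C ≤ D ↔ C.1.toCone ≤ D.1.toCone := h.le_iff
  refine ⟨p, {
    subset := Finset.filter_subset _ _
    mono := fun C D hCD => hle.1 hCD
    salient := fun C => C.1.salient
    mem := hp
    ne_zero := hp0
    cells := {
      neg_mem := fun f hf => neg_mem_forms hf
      separating := fun v hv => eq_zero_of_forms hv
      ne_zero := fun D => hp0 D
      le_iff := fun D E => ?_
      exists_rep := fun v hv => ?_ }
    le_of_faceLE := fun C hC v hv D hD hDv => ?_ }⟩
  · have h1 : D ≤ E ↔ D.1.1.toCone ≤ E.1.1.toCone := hle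
    rw [h1]
    constructor
    · intro h2
      have h3 := h2 (hp D)
      rwa [hcell E E.2, mem_cell] at h3
    · intro h2 y hy
      rw [hcell D D.2, mem_cell] at hy
      rw [hcell E E.2, mem_cell]
      exact hy.trans h2
  · let D : {C : Cones d // C ≠ 0} :=
      ⟨cell L v, ne_zero_iff.2 ⟨v, mem_cell.2 (FaceLE.refl _ v), hv⟩⟩
    have hD : D ∈ nonzeroCells L := mem_nonzeroCells.2 ⟨v, rfl⟩
    refine ⟨⟨D, hD⟩, ?_, mem_cell.1 (hp D)⟩
    have h1 : v ∈ D.1.toCone := mem_cell.2 (FaceLE.refl _ v)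
    rwa [hcell D hD, mem_cell] at h1
  · refine hle.2 fun y hy => ?_
    rw [hcell D hD, mem_cell] at hy
    exact mem_unionsOfCells.1 hC v hv y (hy.trans hDv)

theorem exists_subset_unionsOfCells (s : Finset {C : Cones d // C ≠ 0}) :
    ∃ L, s ⊆ unionsOfCells L := by
  classical
  choose L hL using exists_isUnionOfCells (d := d)
  let M := s.biUnion fun C => L C.1
  have hM : ∀ C ∈ s, L C.1 ⊆ M := fun C hC =>
    Finset.subset_biUnion_of_mem (fun C : {C : Cones d // C ≠ 0} => L C.1) hC
  refine ⟨M, fun C hC => ?_⟩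
  exact mem_unionsOfCells.2 ((hL C.1).mono (hM C hC))

end Cones

theorem theorem5p1 (d : ℕ) (hd : 1 ≤ d) (hconj : Cones.OrderIsInclusion d) :
    (ContractibleSpace (PosetRealization (Cones d)) ∧
      ContractibleSpace (PosetRealization {C : Cones d // C.IsPlus}) ∧
      ContractibleSpace (PosetRealization {C : Cones d // C.IsPlus ∧ C ≠ 0})) ∧
    ∃ 𝒮 : Set (Set (PosetRealization {C : Cones d // C ≠ 0})),
      DirectedOn (· ⊆ ·) 𝒮 ∧ ⋃₀ 𝒮 = Set.univ ∧
      (∀ S ∈ 𝒮, IsClosed S) ∧ Topology.IsCoherentWith 𝒮 ∧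
      ∀ S ∈ 𝒮, ∃ A : Set S, IsStrongDeformationRetract A ∧
        Nonempty (A ≃ₜ Metric.sphere (0 : EuclideanSpace ℝ (Fin d)) 1) := by
  classical
  refine ⟨⟨Cones.contractibleSpace_cones hconj, Cones.contractibleSpace_isPlus hconj,
    Cones.contractibleSpace_isPlus_ne_zero hd hconj⟩, Set.range fun L : Finset (Fin d → ℤ) =>
      GeomRealization.supported (orderComplex {C : Cones d // C ≠ 0}) (Cones.unionsOfCells L),
    ?_, ?_, ?_, ?_, ?_⟩
  · rintro _ ⟨L, rfl⟩ _ ⟨M, rfl⟩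
    refine ⟨_, ⟨L ∪ M, rfl⟩, fun x hx => ?_, fun x hx => ?_⟩
    · exact Set.Subset.trans hx
        (Finset.coe_subset.2 (Cones.unionsOfCells_mono Finset.subset_union_left))
    · exact Set.Subset.trans hx
        (Finset.coe_subset.2 (Cones.unionsOfCells_mono Finset.subset_union_right))
  · refine Set.eq_univ_of_forall fun x => ?_
    obtain ⟨L, hL⟩ := Cones.exists_subset_unionsOfCells x.1.support
    exact ⟨_, ⟨L, rfl⟩, Finset.coe_subset.2 hL⟩
  · rintro _ ⟨L, rfl⟩
    exact GeomRealization.isClosed_supported _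
  · refine GeomRealization.isCoherentWith_supported.enlarge ?_
    rintro _ ⟨s, -, rfl⟩
    obtain ⟨L, hL⟩ := Cones.exists_subset_unionsOfCells s
    exact ⟨_, ⟨L, rfl⟩, fun x hx => Set.Subset.trans hx (Finset.coe_subset.2 hL)⟩
  · rintro _ ⟨L, rfl⟩
    obtain ⟨p, hp⟩ := hconj.exists_isSubdividedBy L
    exact ⟨_, hp.isStrongDeformationRetract,
      hp.nonempty_homeomorph_sphere (EuclideanSpace.equiv (Fin d) ℝ).symm⟩
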